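/- Let $G$ be a locally compact (Hausdorff) group and let $M(G)=C_0(G)^*$ be the space of complex regular Borel measures on $G$, with convolution $\langle\omega\star\nu,f\rangle=\iint f(st)\,d\omega(s)\,d\nu(t)$. For $\omega\in M(G)$ let $|\omega|$ be its total variation, $\|\omega\|=|\omega|(G)$, and let $G_{|\omega|}$ be the closed subgroup generated by $\operatorname{supp}|\omega|$. Let $L_\omega$ be the convolution operator $(L_\omega f)(t)=\int_G f(st)\,d\omega(s)$ on $L^\infty(G)$ (defined there by duality with $L^1(G)$), which maps $C_0(G)$ to $C_0(G)$; let $\operatorname{Fix}L_\omega=\{f\in L^\infty(G): L_\omega f=f\}$, and let $S_n(\omega)=\frac1n\sum_{k=1}^n\omega^{\star k}$. Let $\omega\in M(G)$ with $\|\omega\|\le 1$. Then the following are equivalent: (i) $\operatorname{Fix}L_\omega\cap C_0(G)\neq\{0\}$; (ii) $\|\omega\|=1$, $G_{|\omega|}$ is compact, and there is a continuous character $\chi:G_{|\omega|}\to\mathbb T$ such that $\omega=\chi|\omega|$; (iii) the Cesàro averages $S_n(\omega)$ do not converge weak* to $0$ in $M(G)=C_0(G)^*$. In this case, for $\chi$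 as in (ii) and $m_{G_{|\omega|}}$ the normalised Haar measure of $G_{|\omega|}$ (viewed as a measure on $G$), $S_n(\omega)\to\chi m_{G_{|\omega|}}$ weak*, and $$\operatorname{Fix}L_\omega\cap C_0(G)=\operatorname{Fix}L_{\chi m_{G_{|\omega|}}}\cap C_0(G)=L_{\chi m_{G_{|\omega|}}}(C_0(G)).$$ In particular, if moreover $G$ is compact and $G_{|\omega|}=G$, then $\operatorname{Fix}L_\omega=\mathbb C\,\overline{\chi}$ in $L^\infty(G)$. -/

import Mathlib

open MeasureTheory Filter Topology
open scoped ZeroAtInfty ENNReal Pointwise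

namespace CesaroFix

section Basic

variable {G : Type*} [TopologicalSpace G]

theorem norm_apply_le (f : C₀(G, ℂ)) (s : G) : ‖f s‖ ≤ ‖f‖ := by
  rw [← ZeroAtInftyContinuousMap.norm_toBCF_eq_norm]
  exact f.toBCF.norm_coe_le_norm s

theorem norm_le_of_forall {f : C₀(G, ℂ)} {C : ℝ} (hC : 0 ≤ C) (h : ∀ s, ‖f s‖ ≤ C) :
    ‖f‖ ≤ C := by
  rw [← ZeroAtInftyContinuousMap.norm_toBCF_eq_norm]
  exact (BoundedContinuousFunction.norm_le hC).2 h

/-- Functions in `C₀(G)` are small off a compact set. -/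
theorem exists_compact_small (f : C₀(G, ℂ)) {ε : ℝ} (hε : 0 < ε) :
    ∃ K : Set G, IsCompact K ∧ ∀ s, s ∉ K → ‖f s‖ < ε := by
  have h := (zero_at_infty f).eventually (Metric.ball_mem_nhds (0 : ℂ) hε)
  obtain ⟨K, hK, hsub⟩ := mem_cocompact.1 h
  exact ⟨K, hK, fun s hs => by simpa using hsub hs⟩

/-- A bounded functional on `C₀(G)` is carried, up to a small error, by a compact set. -/
theorem exists_compact_functional_small (ρ : StrongDual ℂ C₀(G, ℂ)) {ε : ℝ} (hε : 0 < ε) :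
    ∃ K : Set G, IsCompact K ∧ ∃ δ > 0, ∀ h : C₀(G, ℂ), ‖h‖ ≤ 1 →
      (∀ s ∈ K, ‖h s‖ ≤ δ) → ‖ρ h‖ ≤ ε := by
  set η : ℝ := ε / (2 * (‖ρ‖ + 1)) with hη
  have hρ := norm_nonneg ρ
  have hηpos : 0 < η := by positivity
  obtain ⟨g, hg1, hg⟩ : ∃ g : C₀(G, ℂ), ‖g‖ ≤ 1 ∧ ‖ρ‖ - ε / 2 ≤ ‖ρ g‖ := by
    by_cases hlt : 0 ≤ ‖ρ‖ - ε / 2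
    · obtain ⟨g, hg1, hg⟩ := ρ.exists_lt_apply_of_lt_opNorm (show ‖ρ‖ - ε / 2 < ‖ρ‖ by linarith)
      exact ⟨g, hg1.le, hg.le⟩
    · exact ⟨0, by simp, by simp; linarith⟩
  obtain ⟨K, hK, hKs⟩ := exists_compact_small g hηpos
  refine ⟨K, hK, η, hηpos, fun h hh1 hhK => ?_⟩
  obtain ⟨θ, hθ, hθe⟩ : ∃ θ : ℂ, ‖θ‖ = 1 ∧ ‖ρ g + θ * ρ h‖ = ‖ρ g‖ + ‖ρ h‖ := by
    by_cases h0 : ρ h = 0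
    · exact ⟨1, by simp, by simp [h0]⟩
    by_cases g0 : ρ g = 0
    · exact ⟨1, by simp, by simp [g0]⟩
    have e1 : (‖ρ g‖ : ℂ) ≠ 0 := by simpa using g0
    have e2 : (‖ρ h‖ : ℂ) ≠ 0 := by simpa using h0
    refine ⟨(ρ g / ‖ρ g‖) * (‖ρ h‖ / ρ h), ?_, ?_⟩
    · simp [h0, g0]
    · have : ρ g + (ρ g / ‖ρ g‖) * (‖ρ h‖ / ρ h) * ρ h
          = (ρ g / ‖ρ g‖) * ((‖ρ g‖ + ‖ρ h‖ : ℝ) : ℂ) := by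
        push_cast
        field_simp
      rw [this, norm_mul, norm_div, Complex.norm_real, Complex.norm_real, norm_norm,
        div_self (by simpa using g0), one_mul, Real.norm_of_nonneg (by positivity)]
  have hnorm : ‖g + θ • h‖ ≤ 1 + η := by
    refine norm_le_of_forall (by positivity) fun s => ?_
    have h1 : ‖(g + θ • h) s‖ ≤ ‖g s‖ + ‖h s‖ := by
      simpa [hθ] using norm_add_le (g s) (θ * h s)
    by_cases hs : s ∈ K
    · linarith [norm_apply_le g s, hhK s hs]
    · linarith [norm_apply_le h s, hKs s hs]
  have hle : ‖ρ g‖ + ‖ρ h‖ ≤ ‖ρ‖ * (1 + η) := by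
    rw [← hθe]
    have : ρ g + θ * ρ h = ρ (g + θ • h) := by simp
    rw [this]
    exact (ρ.le_opNorm _).trans (by gcongr)
  have : ‖ρ‖ * η ≤ ε / 2 := by
    rw [hη, mul_div_assoc', div_le_iff₀ (by positivity)]
    nlinarith
  linarith

end Basic

section Translation

variable {G : Type*} [Group G] [TopologicalSpace G] [IsTopologicalGroup G]

/-- The right translate `s ↦ f (s * t)` of `f ∈ C₀(G)`. -/
noncomputable def rightTranslate (t : G) (f : C₀(G, ℂ)) : C₀(G, ℂ) :=
  f.comp (Homeomorph.mulRight t).toCocompactMap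

@[simp] theorem rightTranslate_apply (t s : G) (f : C₀(G, ℂ)) :
    rightTranslate t f s = f (s * t) := rfl

theorem norm_rightTranslate_le (t : G) (f : C₀(G, ℂ)) : ‖rightTranslate t f‖ ≤ ‖f‖ :=
  norm_le_of_forall (norm_nonneg _) fun s => norm_apply_le f (s * t)

/-- Right translation on `C₀(G)` is norm continuous in the translating element. -/
theorem continuous_rightTranslate [LocallyCompactSpace G] (f : C₀(G, ℂ)) :
    Continuous fun t : G => rightTranslate t f := by
  rw [continuous_iff_continuousAt]
  intro t₀
  rw [ContinuousAt, Metric.tendsto_nhds]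
  intro ε hε
  obtain ⟨K, hK, hKs⟩ := exists_compact_small f (show 0 < ε / 4 by positivity)
  obtain ⟨V, hV, hVn⟩ := exists_compact_mem_nhds t₀
  have hC : IsCompact (K * V⁻¹) := hK.mul hV.inv
  have hev : ∀ᶠ t in 𝓝 t₀, ∀ s ∈ K * V⁻¹, ‖f (s * t) - f (s * t₀)‖ < ε / 2 := by
    refine hC.eventually_forall_of_forall_eventually (x₀ := t₀)
      (P := fun t s => ‖f (s * t) - f (s * t₀)‖ < ε / 2) ?_
    intro s _
    have hcont : Continuous fun z : G × G => ‖f (z.2 * z.1) - f (z.2 * t₀)‖ := by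
      have := map_continuous f
      fun_prop
    refine (hcont.tendsto (t₀, s)).eventually (gt_mem_nhds ?_)
    simpa using hε
  filter_upwards [hev, hVn] with t ht htV
  refine lt_of_le_of_lt (b := ε / 2) ?_ (by linarith)
  rw [dist_eq_norm]
  refine norm_le_of_forall (by positivity) fun s => ?_
  simp only [ZeroAtInftyContinuousMap.sub_apply, rightTranslate_apply]
  by_cases hs : s ∈ K * V⁻¹
  · exact (ht s hs).le
  · have key : ∀ u ∈ V, s * u ∉ K := fun u hu hsu =>
      hs ⟨s * u, hsu, u⁻¹, Set.inv_mem_inv.2 hu, by simp⟩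
    have h1 := hKs _ (key t htV)
    have h2 := hKs _ (key t₀ (mem_of_mem_nhds hVn))
    linarith [norm_sub_le (f (s * t)) (f (s * t₀))]

end Translation

section Convolution

variable {G : Type*} [Group G] [TopologicalSpace G] [IsTopologicalGroup G]
  [LocallyCompactSpace G]

/-- For `ρ ∈ M(G) = C₀(G)*`, the function `t ↦ ρ (s ↦ f (s * t))` as an element of `C₀(G)`. -/
noncomputable def convFun (ρ : StrongDual ℂ C₀(G, ℂ)) (f : C₀(G, ℂ)) : C₀(G, ℂ) where
  toFun t := ρ (rightTranslate t f)
  continuous_toFun := ρ.continuous.comp (continuous_rightTranslate f)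
  zero_at_infty' := by
    rw [Metric.tendsto_nhds]
    intro ε hε
    have hc : (0 : ℝ) < ‖f‖ + 1 := by positivity
    obtain ⟨K, hK, δ, hδ, hKδ⟩ :=
      exists_compact_functional_small ρ (show 0 < ε / 2 / (‖f‖ + 1) by positivity)
    obtain ⟨L, hL, hLs⟩ := exists_compact_small f (show 0 < δ * (‖f‖ + 1) by positivity)
    rw [Filter.Eventually, mem_cocompact]
    refine ⟨K⁻¹ * L, hK.inv.mul hL, fun t ht => ?_⟩
    have key : ∀ s ∈ K, s * t ∉ L := fun s hs hst =>
      ht ⟨s⁻¹, Set.inv_mem_inv.2 hs, s * t, hst, by simp⟩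
    have h := hKδ (((‖f‖ + 1 : ℝ) : ℂ)⁻¹ • rightTranslate t f) ?_ ?_
    · rw [map_smul, norm_smul, norm_inv, Complex.norm_real, Real.norm_of_nonneg hc.le,
        inv_mul_eq_div, div_le_div_iff_of_pos_right hc] at h
      change dist (ρ (rightTranslate t f)) 0 < ε
      rw [dist_zero_right]
      linarith
    · rw [norm_smul, norm_inv, Complex.norm_real, Real.norm_of_nonneg hc.le, inv_mul_eq_div,
        div_le_one hc]
      linarith [norm_rightTranslate_le t f]
    · intro s hs
      rw [ZeroAtInftyContinuousMap.smul_apply, norm_smul, norm_inv, Complex.norm_real,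
        Real.norm_of_nonneg hc.le, inv_mul_eq_div, div_le_iff₀ hc]
      exact (hLs _ (key s hs)).le

/-- The convolution operator `L_ρ` on `C₀(G)`: `(L_ρ f)(t) = ρ (s ↦ f (s * t))`. -/
noncomputable def convOp (ρ : StrongDual ℂ C₀(G, ℂ)) : C₀(G, ℂ) →L[ℂ] C₀(G, ℂ) :=
  LinearMap.mkContinuous
    { toFun := convFun ρ
      map_add' := fun f g => ZeroAtInftyContinuousMap.ext fun t =>
        map_add ρ (rightTranslate t f) (rightTranslate t g)
      map_smul' := fun c f => ZeroAtInftyContinuousMap.ext fun t =>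
        map_smul ρ c (rightTranslate t f) }
    ‖ρ‖ fun f => norm_le_of_forall (by positivity) fun t =>
      (ρ.le_opNorm _).trans (by gcongr; exact norm_rightTranslate_le t f)

@[simp] theorem convOp_apply (ρ : StrongDual ℂ C₀(G, ℂ)) (f : C₀(G, ℂ)) (t : G) :
    convOp ρ f t = ρ (rightTranslate t f) := rfl

/-- The fixed points of `L_ρ` in `C₀(G)`. -/
def fixC0 (ρ : StrongDual ℂ C₀(G, ℂ)) : Set C₀(G, ℂ) := {f | convOp ρ f = f}

/-- Convolution on `M(G) = C₀(G)*`: `(ρ ⋆ ν)(f) = ν (t ↦ ρ (s ↦ f (s * t)))`. -/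
noncomputable def conv (ρ ν : StrongDual ℂ C₀(G, ℂ)) : StrongDual ℂ C₀(G, ℂ) :=
  ν.comp (convOp ρ)

/-- The Dirac measure at the identity, as an element of `C₀(G)*`. -/
noncomputable def diracOne : StrongDual ℂ C₀(G, ℂ) :=
  LinearMap.mkContinuous
    { toFun := fun f => f 1
      map_add' := fun _ _ => rfl
      map_smul' := fun _ _ => rfl }
    1 fun f => by simpa using norm_apply_le f 1

/-- The convolution powers of an element of `M(G)`; the power `0` is the Dirac measure at `1`. -/
noncomputable def convPow (ρ : StrongDual ℂ C₀(G, ℂ)) : ℕ → StrongDual ℂ C₀(G, ℂ)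
  | 0 => diracOne
  | n + 1 => conv (convPow ρ n) ρ

/-- The Cesàro averages `S_n(ρ) = (1/n) ∑_{k=1}^n ρ^{⋆k}`, in `M(G)` with its weak* topology. -/
noncomputable def cesaro (ρ : StrongDual ℂ C₀(G, ℂ)) (n : ℕ) : WeakDual ℂ C₀(G, ℂ) :=
  StrongDual.toWeakDual ((n : ℂ)⁻¹ • ∑ k ∈ Finset.Icc 1 n, convPow ρ k)

end Convolution

section Measures

variable {G : Type*} [TopologicalSpace G] [MeasurableSpace G]

/-- The total variation of a complex measure is finite. -/
theorem isFiniteMeasure_variation {X : Type*} [MeasurableSpace X] (ω : ComplexMeasure X) :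
    IsFiniteMeasure ω.variation := by
  have hle : ω.variation ≤
      (ComplexMeasure.re ω).totalVariation + (ComplexMeasure.im ω).totalVariation := by
    refine VectorMeasure.variation_le_of_forall_enorm_le fun E _ => ?_
    have h1 := SignedMeasure.enorm_le_totalVariation (ComplexMeasure.re ω) E
    have h2 := SignedMeasure.enorm_le_totalVariation (ComplexMeasure.im ω) E
    have h3 : ‖ω E‖ₑ ≤ ‖(ω E).re‖ₑ + ‖(ω E).im‖ₑ := by
      simp only [enorm_eq_nnnorm]
      exact_mod_cast Complex.norm_le_abs_re_add_abs_im (ω E)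
    exact h3.trans (add_le_add h1 h2)
  have f1 : IsFiniteMeasure (ComplexMeasure.re ω).totalVariation := by
    unfold SignedMeasure.totalVariation; infer_instance
  have f2 : IsFiniteMeasure (ComplexMeasure.im ω).totalVariation := by
    unfold SignedMeasure.totalVariation; infer_instance
  exact isFiniteMeasure_of_le _ hle

/-- The integral `∫ f dω` of a complex function against a complex measure. -/
noncomputable def cintegral {X : Type*} [MeasurableSpace X] (ω : ComplexMeasure X)
    (f : X → ℂ) : ℂ :=
  VectorMeasure.integral ω f (ContinuousLinearMap.mul ℝ ℂ)

theorem cintegral_const_mul {X : Type*} [MeasurableSpace X] (ω : ComplexMeasure X) (c : ℂ)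
    (f : X → ℂ) : cintegral ω (fun x => c * f x) = c * cintegral ω f :=
  setToFun_smul (𝕜 := ℂ) _ (fun c s x => by
    change (c * x) * ω s = c * (x * ω s)
    ring) c f

theorem integrable_variation [BorelSpace G] (ω : ComplexMeasure G) (f : C₀(G, ℂ)) :
    Integrable f ω.variation := by
  have := isFiniteMeasure_variation ω
  exact Integrable.of_bound (map_continuous f).measurable.aestronglyMeasurable ‖f‖
    (Eventually.of_forall (norm_apply_le f))

/-- The functional `f ↦ ∫ f dω` on `C₀(G)` given by a complex Borel measure `ω`. -/
noncomputable def toDual [BorelSpace G] (ω : ComplexMeasure G) : StrongDual ℂ C₀(G, ℂ) :=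
  LinearMap.mkContinuous
    { toFun := fun f => cintegral ω f
      map_add' := fun f g => VectorMeasure.integral_fun_add
        (integrable_variation ω f) (integrable_variation ω g)
      map_smul' := fun c f => cintegral_const_mul ω c f }
    (ω.variation.real Set.univ) fun f => by
      have := isFiniteMeasure_variation ω
      have h := VectorMeasure.norm_integral_le_of_norm_le_const (μ := ω)
        (B := ContinuousLinearMap.mul ℝ ℂ) (Eventually.of_forall (norm_apply_le f))
      rw [ContinuousLinearMap.opNorm_mul, mul_one, mul_comm] at h
      exact h

@[simp] theorem toDual_apply [BorelSpace G] (ω : ComplexMeasure G) (f : C₀(G, ℂ)) :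
    toDual ω f = cintegral ω f := rfl

/-- The closed subgroup `G_μ` of `G` generated by the support of `μ`. -/
def supportSubgroup [Group G] [IsTopologicalGroup G] (μ : Measure G) : Subgroup G :=
  (Subgroup.closure μ.support).topologicalClosure

open Classical in
/-- The extension by zero to `G` of a character `χ` of a subgroup `K`. -/
noncomputable def charExtend [Group G] {K : Subgroup G} (χ : K →ₜ* Circle) (s : G) : ℂ :=
  if h : s ∈ K then (χ ⟨s, h⟩ : ℂ) else 0

/-- The complex measure `χ μ`, for a continuous character `χ` of a closed subgroup `K` of `G` and
a finite measure `μ` on `G` (in the applications `μ` is carried by `K`). -/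
noncomputable def charMeasure [Group G] {K : Subgroup G} (χ : K →ₜ* Circle) (μ : Measure G) :
    ComplexMeasure G :=
  μ.withDensityᵥ (charExtend χ)

/-- The normalised Haar measure `m_K` of a compact subgroup `K`, as a measure on `G`. -/
noncomputable def haarOn [Group G] [IsTopologicalGroup G] [BorelSpace G]
    (K : Subgroup G) [CompactSpace K] : Measure G :=
  (Measure.haarMeasure (⊤ : TopologicalSpace.PositiveCompacts K)).map Subtype.val

/-- The fixed points in `L^∞(G, m)` of the convolution operator `L_ω`. Here `L_ω f ∈ L^∞` is the
element determined by the duality with `L¹`, namely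
`∫ φ(t) (L_ω f)(t) dm(t) = ∫ (∫ φ(t) f(s t) dm(t)) dω(s)` for all `φ ∈ L¹(G, m)`. -/
def fixLinfty {G : Type*} [Group G] [MeasurableSpace G] (m : Measure G) (ω : ComplexMeasure G) : Set (Lp ℂ ∞ m) :=
  {f | ∀ φ : Lp ℂ 1 m,
    ∫ t, φ t * f t ∂m = cintegral ω (fun s => ∫ t, φ t * f (s * t) ∂m)}

end Measures

end CesaroFix

open CesaroFix

/-!
Let `L f (t) = ∫ f (s t) dω(s)` be the convolution operator of a complex measure `ω` of total
variation at most `1` on a locally compact group, and let `K` be the closed subgroup generated by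
the support of `|ω|`.

*A fixed point gives a character.* If `0 ≠ f ∈ C₀(G)` is fixed and `|f|` is maximal at `t`, then
equality holds in `|f(t)| ≤ ∫ |f (s t)| d|ω|(s) ≤ |f(t)|`. This forces `|ω|(G) = 1` and
`ω = conj F |ω|` with `F(s) = f (s t) / f(t)` (`eq_withDensityᵥ_of_cintegral_eq_one`), where `F`
does not depend on the maximum point `t`. The elements `s` acting by the factor `F(s)` on the
compact set of maximum points form a compact submonoid of `G` containing the support of `|ω|`. A
compact submonoid is a group (`inv_mem_of_isCompact_submonoid`), so `K` is compact and `conj F`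
restricts to a character of `K` (`exists_character_of_fixC0`).

*No fixed point gives convergence to zero.* If `ν` is a weak* cluster point of the Cesàro averages,
then `ν ⋆ ω = ν`, hence `L_ν f` is fixed by `L` for each `f`; if the only fixed point is `0`, then
`ν = 0` (`tendsto_cesaro_zero_of_fixC0`). The delicate point, weak* continuity of `ν ↦ ν ⋆ ω` on
bounded sets, is `tendsto_apply_convOp`.

*The case `ω = χ |ω|` with `K` compact.* Here everything rests on the maximum principle on the
compact group `K` (`eq_apply_one_of_harmonic`): continuous functions with the mean value property
for a measure whose support generates `K` are constant. Applied to `k ↦ χ(k) f (k t)`, it shows that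
the fixed points are the `f` with `f (k t) = conj χ(k) f(t)` for `k ∈ K`, a condition which involves
only `χ` and `K`. Thus `ω` and `χ m_K` have the same fixed points, and `P = L_{χ m_K}` is a
projection onto them. Applied to `k ↦ χ(k) φ (f (k ·))` for a functional `φ` with `φ ∘ L = φ`, it
gives `φ ∘ P = φ`. By Hahn–Banach the kernel of `P` is contained in the closure of the range of
`L - 1`, and the mean ergodic theorem gives the convergence of the Cesàro averages
(`tendsto_birkhoffAverage_convOp`). The limit `χ m_K` is not zero, which closes the circle of
equivalences.

*Fixed points in `L^∞`.* If `G = K` and `f ∈ L^∞` is fixed, the maximum principle for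
`k ↦ χ(k) Φ (g (k⁻¹ ·))` with `Φ(g) = ∫ g f dm` gives `Φ (g (k ·)) = χ(k) Φ(g)` for `g ∈ C(G)`.
Averaging over `k` yields `Φ(g) = c ∫ g conj χ dm`, so `f = c conj χ` almost everywhere.
-/

namespace CesaroFix

/-! ### Compact subsemigroups of groups -/

/-- A compact submonoid of a Hausdorff topological group is a subgroup: for `s` in the submonoid
`T`, the compact semigroup `s T` contains an idempotent, which must be `1`. -/
theorem inv_mem_of_isCompact_submonoid {G : Type*} [Group G] [TopologicalSpace G]
    [IsTopologicalGroup G] [T2Space G] (T : Submonoid G) (hT : IsCompact (T : Set G)) {s : G}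
    (hs : s ∈ T) : s⁻¹ ∈ T := by
  obtain ⟨m, ⟨x, hx, rfl⟩, hm⟩ := exists_idempotent_in_compact_subsemigroup
    (fun r : G => continuous_mul_const r) ((fun x => s * x) '' (T : Set G))
    ⟨_, 1, T.one_mem, rfl⟩ (hT.image (continuous_const_mul s)) (by
      rintro _ ⟨x, hx, rfl⟩ _ ⟨y, hy, rfl⟩
      exact ⟨x * (s * y), T.mul_mem hx (T.mul_mem hs hy), by simp [mul_assoc]⟩)
  have h1 : s * x = 1 := by simpa using hm
  rwa [inv_eq_of_mul_eq_one_right h1]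

/-! ### Integration against complex measures -/

section Integration

variable {X : Type*} [MeasurableSpace X]

theorem norm_cintegral_le (ω : ComplexMeasure X) (f : X → ℂ) :
    ‖cintegral ω f‖ ≤ ∫ x, ‖f x‖ ∂ω.variation := by
  have h := VectorMeasure.norm_integral_le_integral_norm (μ := ω) (f := f)
    (B := ContinuousLinearMap.mul ℝ ℂ)
  rwa [ContinuousLinearMap.opNorm_mul, one_mul] at h

theorem cintegral_add (ω : ComplexMeasure X) {f g : X → ℂ} (hf : Integrable f ω.variation)
    (hg : Integrable g ω.variation) :
    cintegral ω (fun x => f x + g x) = cintegral ω f + cintegral ω g :=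
  VectorMeasure.integral_fun_add hf hg

theorem cintegral_sub (ω : ComplexMeasure X) {f g : X → ℂ} (hf : Integrable f ω.variation)
    (hg : Integrable g ω.variation) :
    cintegral ω (fun x => f x - g x) = cintegral ω f - cintegral ω g :=
  VectorMeasure.integral_fun_sub hf hg

theorem cintegral_congr_ae (ω : ComplexMeasure X) {f g : X → ℂ} (h : f =ᵐ[ω.variation] g) :
    cintegral ω f = cintegral ω g :=
  VectorMeasure.integral_congr_ae h

theorem cintegral_indicator_one (ω : ComplexMeasure X) {s : Set X} (hs : MeasurableSet s) :
    cintegral ω (s.indicator fun _ => 1) = ω s := by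
  have := isFiniteMeasure_variation ω
  have h := VectorMeasure.integral_indicator_const (μ := ω) (B := ContinuousLinearMap.mul ℝ ℂ)
    (1 : ℂ) hs
  simpa [cintegral] using h

/-- If integrating `F` against `ω` over measurable sets is the same as integrating `h` against `μ`,
then `F ω = h μ` as functionals on `L¹(μ)`. -/
theorem cintegral_mul_eq_integral_mul (ω : ComplexMeasure X) (μ : Measure X) [IsFiniteMeasure μ]
    (hωμ : ω.variation ≤ μ) {F h : X → ℂ} (hF : Measurable F) (hF1 : ∀ x, ‖F x‖ ≤ 1)
    (hh : Measurable h) (hh1 : ∀ x, ‖h x‖ ≤ 1)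
    (H : ∀ s, MeasurableSet s → cintegral ω (fun x => F x * s.indicator (fun _ => 1) x) =
      ∫ x in s, h x ∂μ) {g : X → ℂ} (hg : Integrable g μ) :
    cintegral ω (fun x => F x * g x) = ∫ x, h x * g x ∂μ := by
  have intF : ∀ {g : X → ℂ}, Integrable g μ → Integrable (fun x => F x * g x) ω.variation :=
    fun hg => (hg.bdd_mul hF.aestronglyMeasurable (.of_forall hF1)).mono_measure hωμ
  have inth : ∀ {g : X → ℂ}, Integrable g μ → Integrable (fun x => h x * g x) μ :=
    fun hg => hg.bdd_mul hh.aestronglyMeasurable (.of_forall hh1)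
  refine Integrable.induction (fun g : X → ℂ =>
    cintegral ω (fun x => F x * g x) = ∫ x, h x * g x ∂μ) ?_ ?_ ?_ ?_ hg
  · intro c s hs _
    have e1 : (fun x => F x * s.indicator (fun _ => c) x) =
        fun x => c * (F x * s.indicator (fun _ => 1) x) := by
      ext x; by_cases hx : x ∈ s <;> simp [hx, mul_comm]
    have e2 : (fun x => h x * s.indicator (fun _ => c) x) = s.indicator fun x => c * h x := by
      ext x; by_cases hx : x ∈ s <;> simp [hx, mul_comm]
    rw [e1, cintegral_const_mul, H s hs, e2, MeasureTheory.integral_indicator hs,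
      MeasureTheory.integral_const_mul]
  · intro f g _ hf hg hf' hg'
    simp only [Pi.add_apply, mul_add]
    rw [cintegral_add ω (intF hf) (intF hg), hf', hg',
      MeasureTheory.integral_add (inth hf) (inth hg)]
  · -- both sides are `1`-Lipschitz for the `L¹` distance
    have key : ∀ T : (X → ℂ) → ℂ, (∀ f g : X →₁[μ] ℂ, ‖T f - T g‖ ≤ ∫ x, ‖f x - g x‖ ∂μ) →
        Continuous fun f : X →₁[μ] ℂ => T f := fun T hT => by
      refine LipschitzWith.continuous (K := 1) (LipschitzWith.of_dist_le_mul fun f g => ?_)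
      rw [NNReal.coe_one, one_mul, dist_eq_norm, L1.dist_eq_integral_dist]
      simpa only [dist_eq_norm] using hT f g
    refine isClosed_eq (key (fun g => cintegral ω fun x => F x * g x) fun f g => ?_)
      (key (fun g => ∫ x, h x * g x ∂μ) fun f g => ?_)
    · have hf := L1.integrable_coeFn f
      have hg := L1.integrable_coeFn g
      rw [← cintegral_sub ω (intF hf) (intF hg)]
      refine (norm_cintegral_le _ _).trans ?_
      refine (integral_mono_measure hωμ (.of_forall fun x => norm_nonneg _) ?_).trans
        (integral_mono ?_ (hf.sub hg).norm fun x => ?_)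
      iterate 2
        · simp only [← mul_sub]
          exact ((hf.sub hg).bdd_mul hF.aestronglyMeasurable (.of_forall hF1)).norm
      · simp only [← mul_sub, norm_mul]
        exact mul_le_of_le_one_left (norm_nonneg _) (hF1 x)
    · have hf := L1.integrable_coeFn f
      have hg := L1.integrable_coeFn g
      rw [← MeasureTheory.integral_sub (inth hf) (inth hg)]
      refine (MeasureTheory.norm_integral_le_integral_norm _).trans
        (integral_mono ?_ (hf.sub hg).norm fun x => ?_)
      · exact ((inth hf).sub (inth hg)).norm
      · simp only [← mul_sub, norm_mul]
        exact mul_le_of_le_one_left (norm_nonneg _) (hh1 x)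
  · intro f g hfg _ hf
    have e1 : cintegral ω (fun x => F x * g x) = cintegral ω (fun x => F x * f x) :=
      cintegral_congr_ae ω <| (Measure.absolutelyContinuous_of_le hωμ).ae_le <| by
        filter_upwards [hfg] with x hx
        rw [hx]
    rw [e1, hf]
    refine MeasureTheory.integral_congr_ae ?_
    filter_upwards [hfg] with x hx
    rw [hx]

/-- Integration against the complex measure `h μ`, for a density `h` with `|h| ≤ 1`. -/
theorem cintegral_withDensityᵥ (μ : Measure X) [IsFiniteMeasure μ] {h : X → ℂ}
    (hh : Measurable h) (hh1 : ∀ x, ‖h x‖ ≤ 1) {g : X → ℂ} (hg : Integrable g μ) :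
    cintegral (μ.withDensityᵥ h) g = ∫ x, h x * g x ∂μ := by
  have hint : Integrable h μ := .of_bound hh.aestronglyMeasurable 1 (.of_forall hh1)
  have hvar : (μ.withDensityᵥ h).variation ≤ μ := by
    refine VectorMeasure.variation_le_of_forall_enorm_le fun s hs => ?_
    rw [withDensityᵥ_apply hint hs]
    calc ‖∫ x in s, h x ∂μ‖ₑ ≤ ∫⁻ x in s, ‖h x‖ₑ ∂μ := enorm_integral_le_lintegral_enorm _
      _ ≤ ∫⁻ x in s, 1 ∂μ := lintegral_mono fun x => by
          rw [← ofReal_norm]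
          exact ENNReal.ofReal_le_one.2 (hh1 x)
      _ = μ s := by simp
  have := cintegral_mul_eq_integral_mul (μ.withDensityᵥ h) μ hvar (F := fun _ => 1)
    measurable_const (by simp) hh hh1 (fun s hs => ?_) hg
  · simpa using this
  · simp only [one_mul]
    rw [cintegral_indicator_one _ hs, withDensityᵥ_apply hint hs]

/-- The equality case of `1 = |z + w| ≤ |z| + |w| ≤ m + (1 - m)`. -/
theorem eq_ofReal_of_add_eq_one {z w : ℂ} {m : ℝ} (h : z + w = 1) (hz : ‖z‖ ≤ m)
    (hw : ‖w‖ ≤ 1 - m) : z = m := by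
  have h1 : z.re + w.re = 1 := by simpa using congrArg Complex.re h
  have h2 := Complex.re_le_norm w
  have h3 : z.re ≤ ‖z‖ := Complex.re_le_norm z
  have h4 : z.re = ‖z‖ := by linarith
  have h5 : z.im = 0 :=
    Complex.abs_re_eq_norm.1 (by rw [h4, abs_of_nonneg (norm_nonneg z)])
  exact Complex.ext (by simp; linarith) (by simpa using h5)

/-- The equality case of `|∫ F dω| ≤ |ω|(X)` for `|F| ≤ 1` and `|ω|(X) ≤ 1`: if `∫ F dω = 1`, then
`|ω|(X) = 1`, `|F| = 1` almost everywhere, and `ω = conj F |ω|`. Indeed the complex measure `F ω` is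
bounded by the measure `|ω|` and has the same total mass, so `F ω = |ω|`. -/
theorem eq_withDensityᵥ_of_cintegral_eq_one (ω : ComplexMeasure X)
    (hω : ω.variation Set.univ ≤ 1) {F : X → ℂ} (hF : Measurable F) (hF1 : ∀ x, ‖F x‖ ≤ 1)
    (h : cintegral ω F = 1) :
    ω.variation Set.univ = 1 ∧ (∀ᵐ x ∂ω.variation, ‖F x‖ = 1) ∧
      ω = ω.variation.withDensityᵥ fun x => star (F x) := by
  set μ := ω.variation with hμ
  have hfin : IsFiniteMeasure μ := isFiniteMeasure_variation ω
  have hFint : Integrable F μ := .of_bound hF.aestronglyMeasurable 1 (.of_forall hF1)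
  have h1 : 1 ≤ ∫ x, ‖F x‖ ∂μ := by simpa [h] using norm_cintegral_le ω F
  have h2 : ∫ x, ‖F x‖ ∂μ ≤ μ.real Set.univ := by
    simpa using integral_mono hFint.norm (integrable_const (1 : ℝ)) hF1
  have h3 : μ.real Set.univ ≤ 1 := ENNReal.toReal_le_of_le_ofReal zero_le_one (by simpa using hω)
  have huniv : μ.real Set.univ = 1 := by linarith
  have hunit : ∀ᵐ x ∂μ, ‖F x‖ = 1 := by
    have h0 : ∫ x, (1 - ‖F x‖) ∂μ = 0 := by
      rw [MeasureTheory.integral_sub (integrable_const _) hFint.norm]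
      simp only [MeasureTheory.integral_const, smul_eq_mul, mul_one]
      linarith
    filter_upwards [(integral_eq_zero_iff_of_nonneg (fun x => sub_nonneg.2 (hF1 x))
      (f := fun x => 1 - ‖F x‖) ((integrable_const _).sub hFint.norm)).1 h0] with x hx
    simp only [Pi.zero_apply] at hx
    linarith
  -- the mass `1` of `F ω` splits over `s` and its complement without cancellation
  have hset : ∀ s, MeasurableSet s →
      cintegral ω (fun x => F x * s.indicator (fun _ => 1) x) = ∫ x in s, (1 : ℂ) ∂μ := by
    have hb : ∀ s, MeasurableSet s →
        ‖cintegral ω (fun x => F x * s.indicator (fun _ => 1) x)‖ ≤ μ.real s := fun s hs => by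
      refine (norm_cintegral_le _ _).trans ?_
      rw [← setIntegral_one_eq_measureReal, ← MeasureTheory.integral_indicator hs]
      refine integral_mono_of_nonneg (.of_forall fun x => norm_nonneg _)
        ((integrable_const _).indicator hs) (.of_forall fun x => ?_)
      by_cases hx : x ∈ s <;> simp [hx, hF1 x]
    intro s hs
    have hadd : cintegral ω (fun x => F x * s.indicator (fun _ => 1) x) +
        cintegral ω (fun x => F x * sᶜ.indicator (fun _ => 1) x) = 1 := by
      rw [← cintegral_add]
      · refine Eq.trans (congrArg (cintegral ω) ?_) h
        ext x
        by_cases hx : x ∈ s <;> simp [hx]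
      all_goals
        refine Integrable.bdd_mul (c := 1) ?_ hF.aestronglyMeasurable (.of_forall hF1)
        refine (integrable_const _).indicator ?_
        first | exact hs | exact hs.compl
    have hs1 := hb s hs
    have hs2 := hb sᶜ hs.compl
    rw [measureReal_compl hs, huniv] at hs2
    rw [setIntegral_const, Complex.real_smul, mul_one]
    exact eq_ofReal_of_add_eq_one hadd hs1 hs2
  refine ⟨?_, hunit, ?_⟩
  · rwa [measureReal_def, ENNReal.toReal_eq_one_iff] at huniv
  · ext1 s hs
    have hint : Integrable (fun x => star (F x)) μ :=
      .of_bound (continuous_star.measurable.comp hF).aestronglyMeasurable 1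
        (.of_forall fun x => by simpa using hF1 x)
    rw [withDensityᵥ_apply hint hs, ← MeasureTheory.integral_indicator hs,
      ← cintegral_indicator_one ω hs]
    have := cintegral_mul_eq_integral_mul ω μ le_rfl hF hF1 (h := fun _ => 1)
      measurable_const (by simp) hset (hint.indicator hs)
    simp only [one_mul] at this
    rw [← this]
    refine cintegral_congr_ae ω ?_
    filter_upwards [hunit] with x hx
    by_cases hxs : x ∈ s
    · simp [hxs, Complex.mul_conj, Complex.normSq_eq_norm_sq, hx]
    · simp [hxs]

end Integration

/-! ### Functions vanishing at infinity, translations and supports -/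

section Topological

variable {G : Type*} [TopologicalSpace G]

theorem sum_apply_point {ι : Type*} (s : Finset ι) (g : ι → C₀(G, ℂ)) (t : G) :
    (∑ k ∈ s, g k) t = ∑ k ∈ s, g k t := by
  classical
  induction s using Finset.induction_on with
  | empty => rfl
  | insert a s ha ih =>
    rw [Finset.sum_insert ha, Finset.sum_insert ha, ZeroAtInftyContinuousMap.add_apply, ih]

/-- A nonzero function in `C₀(G)` attains the maximum of its modulus. -/
theorem exists_norm_eq_norm {f : C₀(G, ℂ)} (hf : f ≠ 0) : ∃ t, ‖f t‖ = ‖f‖ ∧ 0 < ‖f‖ := by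
  have hpos : 0 < ‖f‖ := norm_pos_iff.2 hf
  obtain ⟨K, hK, hKs⟩ := exists_compact_small f (half_pos hpos)
  have hne : K.Nonempty := by
    by_contra h
    rw [Set.not_nonempty_iff_eq_empty] at h
    have := norm_le_of_forall (half_pos hpos).le fun s => (hKs s (by simp [h])).le
    linarith
  obtain ⟨t, -, ht⟩ := hK.exists_isMaxOn hne (map_continuous f).norm.continuousOn
  refine ⟨t, le_antisymm (norm_apply_le f t) ?_, hpos⟩
  have h2 : ‖f‖ ≤ max ‖f t‖ (‖f‖ / 2) := norm_le_of_forall (by positivity) fun s => by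
    by_cases hs : s ∈ K
    · exact (ht hs).trans (le_max_left _ _)
    · exact (hKs s hs).le.trans (le_max_right _ _)
  rcases le_max_iff.1 h2 with h | h <;> linarith

theorem isCompact_norm_eq {f : C₀(G, ℂ)} {c : ℝ} (hc : 0 < c) : IsCompact {t | ‖f t‖ = c} := by
  obtain ⟨K, hK, hKs⟩ := exists_compact_small f hc
  exact hK.of_isClosed_subset (isClosed_eq (map_continuous f).norm continuous_const)
    fun t (ht : ‖f t‖ = c) => by_contra fun h => (hKs t h).ne ht

theorem norm_toDual_le [MeasurableSpace G] [BorelSpace G] (ω : ComplexMeasure G) :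
    ‖toDual ω‖ ≤ ω.variation.real Set.univ :=
  LinearMap.mkContinuous_norm_le _ measureReal_nonneg _

theorem norm_toDual_le_one [MeasurableSpace G] [BorelSpace G] {ω : ComplexMeasure G}
    (hω : ω.variation Set.univ ≤ 1) : ‖toDual ω‖ ≤ 1 :=
  (norm_toDual_le ω).trans (ENNReal.toReal_le_of_le_ofReal zero_le_one (by simpa using hω))

variable [Group G]

@[simp] theorem diracOne_apply (f : C₀(G, ℂ)) : diracOne f = f 1 := rfl

theorem norm_diracOne_le : ‖(diracOne : StrongDual ℂ C₀(G, ℂ))‖ ≤ 1 :=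
  LinearMap.mkContinuous_norm_le _ zero_le_one _

theorem charExtend_of_mem {K : Subgroup G} (χ : K →ₜ* Circle) {s : G} (hs : s ∈ K) :
    charExtend χ s = χ ⟨s, hs⟩ := dif_pos hs

variable [IsTopologicalGroup G]

@[simp] theorem rightTranslate_one (f : C₀(G, ℂ)) : rightTranslate 1 f = f :=
  ZeroAtInftyContinuousMap.ext fun s => by simp

theorem rightTranslate_rightTranslate (s t : G) (f : C₀(G, ℂ)) :
    rightTranslate s (rightTranslate t f) = rightTranslate (s * t) f :=
  ZeroAtInftyContinuousMap.ext fun x => by simp [mul_assoc]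

variable [MeasurableSpace G]

theorem supportSubgroup_le {μ : Measure G} {H : Subgroup G} (hH : IsClosed (H : Set G))
    (h : μ.support ⊆ H) : supportSubgroup μ ≤ H :=
  Subgroup.topologicalClosure_minimal _ ((Subgroup.closure_le H).2 h) hH

theorem isClosed_supportSubgroup (μ : Measure G) : IsClosed (supportSubgroup μ : Set G) :=
  Subgroup.isClosed_topologicalClosure _

theorem support_subset_supportSubgroup (μ : Measure G) : μ.support ⊆ supportSubgroup μ :=
  Subgroup.subset_closure.trans (Subgroup.le_topologicalClosure _)

end Topological

/-! ### Convolution powers and Cesàro averages -/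

section Convolution

variable {G : Type*} [Group G] [TopologicalSpace G] [IsTopologicalGroup G]
  [LocallyCompactSpace G]

@[simp] theorem conv_apply (ρ ν : StrongDual ℂ C₀(G, ℂ)) (f : C₀(G, ℂ)) :
    conv ρ ν f = ν (convOp ρ f) := rfl

theorem convOp_apply_one (ρ : StrongDual ℂ C₀(G, ℂ)) (f : C₀(G, ℂ)) : convOp ρ f 1 = ρ f := by
  simp

theorem convOp_rightTranslate (ρ : StrongDual ℂ C₀(G, ℂ)) (t : G) (f : C₀(G, ℂ)) :
    convOp ρ (rightTranslate t f) = rightTranslate t (convOp ρ f) :=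
  ZeroAtInftyContinuousMap.ext fun x => by simp [rightTranslate_rightTranslate]

theorem convOp_conv (ρ ν : StrongDual ℂ C₀(G, ℂ)) (f : C₀(G, ℂ)) :
    convOp (conv ρ ν) f = convOp ν (convOp ρ f) :=
  ZeroAtInftyContinuousMap.ext fun x => by simp [convOp_rightTranslate]

theorem norm_convOp_le (ρ : StrongDual ℂ C₀(G, ℂ)) : ‖convOp ρ‖ ≤ ‖ρ‖ :=
  LinearMap.mkContinuous_norm_le _ ρ.opNorm_nonneg _

theorem norm_conv_le (ρ ν : StrongDual ℂ C₀(G, ℂ)) : ‖conv ρ ν‖ ≤ ‖ν‖ * ‖ρ‖ :=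
  (ContinuousLinearMap.opNorm_comp_le _ _).trans (by gcongr; exact norm_convOp_le ρ)

theorem norm_convPow_le_one {ρ : StrongDual ℂ C₀(G, ℂ)} (hρ : ‖ρ‖ ≤ 1) (n : ℕ) :
    ‖convPow ρ n‖ ≤ 1 := by
  induction n with
  | zero => exact norm_diracOne_le
  | succ n ih => exact (norm_conv_le _ _).trans (mul_le_one₀ hρ (convPow ρ n).opNorm_nonneg ih)

theorem convOp_convPow (ρ : StrongDual ℂ C₀(G, ℂ)) (n : ℕ) (f : C₀(G, ℂ)) :
    convOp (convPow ρ n) f = (convOp ρ)^[n] f := by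
  induction n with
  | zero => exact ZeroAtInftyContinuousMap.ext fun x => by simp [convPow]
  | succ n ih => rw [Function.iterate_succ_apply', ← ih, convPow, convOp_conv]

theorem cesaro_apply (ρ : StrongDual ℂ C₀(G, ℂ)) (n : ℕ) (f : C₀(G, ℂ)) :
    WeakDual.toStrongDual (cesaro ρ n) f = (n : ℂ)⁻¹ * ∑ k ∈ Finset.Icc 1 n, convPow ρ k f := by
  change ((n : ℂ)⁻¹ • ∑ k ∈ Finset.Icc 1 n, convPow ρ k) f = _
  simp

/-- The convolution operator of the Cesàro average `(1/n) ∑_{k=1}^n ρ^{⋆k}` is the Birkhoff average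
of the iterates of `L_ρ`; as the latter starts with the iterate `0`, it is evaluated at `L_ρ f`. -/
theorem convOp_cesaro (ρ : StrongDual ℂ C₀(G, ℂ)) (n : ℕ) (f : C₀(G, ℂ)) :
    convOp (WeakDual.toStrongDual (cesaro ρ n)) f =
      birkhoffAverage ℂ (convOp ρ) _root_.id n (convOp ρ f) := by
  refine ZeroAtInftyContinuousMap.ext fun t => ?_
  rw [convOp_apply, cesaro_apply, birkhoffAverage, birkhoffSum,
    ZeroAtInftyContinuousMap.smul_apply, smul_eq_mul, sum_apply_point, Finset.range_eq_Ico,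
    ← Finset.Ico_add_one_right_eq_Icc, ← zero_add 1, ← Finset.sum_Ico_add' _ 0 n 1]
  congr 1
  refine Finset.sum_congr rfl fun k _ => ?_
  rw [← convOp_apply, convOp_convPow, Function.iterate_succ_apply, _root_.id]

theorem cesaro_apply_eq_birkhoffAverage (ρ : StrongDual ℂ C₀(G, ℂ)) (n : ℕ) (f : C₀(G, ℂ)) :
    cesaro ρ n f = birkhoffAverage ℂ (convOp ρ) _root_.id n (convOp ρ f) 1 := by
  rw [← convOp_cesaro, convOp_apply_one]
  rfl

theorem apply_birkhoffAverage {E : Type*} [AddCommGroup E] [Module ℂ E] (T : E →ₗ[ℂ] E)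
    (n : ℕ) (x : E) :
    T (birkhoffAverage ℂ T _root_.id n x) = birkhoffAverage ℂ T _root_.id n (T x) := by
  simp [birkhoffAverage, birkhoffSum, ← Function.iterate_succ_apply, Function.iterate_succ_apply']

theorem norm_cesaro_le_one {ρ : StrongDual ℂ C₀(G, ℂ)} (hρ : ‖ρ‖ ≤ 1) (n : ℕ) :
    ‖WeakDual.toStrongDual (cesaro ρ n)‖ ≤ 1 := by
  refine ContinuousLinearMap.opNorm_le_bound _ zero_le_one fun f => ?_
  rw [cesaro_apply, norm_mul, norm_inv, Complex.norm_natCast, one_mul]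
  have h : ‖∑ k ∈ Finset.Icc 1 n, convPow ρ k f‖ ≤ n * ‖f‖ := by
    simpa using norm_sum_le_of_le (Finset.Icc 1 n) fun k _ =>
      (convPow ρ k).le_of_opNorm_le (norm_convPow_le_one hρ k) f
  refine (mul_le_mul_of_nonneg_left h (by positivity)).trans ?_
  rw [← mul_assoc]
  exact mul_le_of_le_one_left (norm_nonneg _) inv_mul_le_one

theorem lipschitzWith_convOp {ρ : StrongDual ℂ C₀(G, ℂ)} (hρ : ‖ρ‖ ≤ 1) :
    LipschitzWith 1 (convOp ρ) :=
  (convOp ρ).lipschitzWith_of_opNorm_le ((norm_convOp_le ρ).trans hρ)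

/-- Weak* convergence of a bounded family `A n → ν` is uniform on norm compact sets. Therefore
`L_{A n} f → L_ν f` uniformly on compact subsets of `G`, and this convergence is respected by
functionals on `C₀(G)` as these are almost carried by compact sets. -/
theorem tendsto_apply_convOp {ι : Type*} {l : Filter ι} {A : ι → StrongDual ℂ C₀(G, ℂ)}
    {ν : StrongDual ℂ C₀(G, ℂ)} (hA : ∀ n, ‖A n‖ ≤ 1) (hν : ‖ν‖ ≤ 1)
    (h : ∀ f, Tendsto (fun n => A n f) l (𝓝 (ν f))) (ρ : StrongDual ℂ C₀(G, ℂ)) (f : C₀(G, ℂ)) :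
    Tendsto (fun n => ρ (convOp (A n) f)) l (𝓝 (ρ (convOp ν f))) := by
  rw [Metric.tendsto_nhds]
  intro ε hε
  set M : ℝ := 2 * ‖f‖ + 1 with hM
  have hMpos : 0 < M := by positivity
  obtain ⟨K, hK, δ, hδ, hKδ⟩ :=
    exists_compact_functional_small ρ (show 0 < ε / 2 / M by positivity)
  have hη : 0 < δ * M / 3 := by positivity
  have hunif : ∀ᶠ n in l, ∀ t ∈ K, ‖convOp (A n) f t - convOp ν f t‖ ≤ δ * M := by
    refine hK.induction_on (p := fun S => ∀ᶠ n in l, ∀ t ∈ S,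
      ‖convOp (A n) f t - convOp ν f t‖ ≤ δ * M) (by simp) ?_ ?_ ?_
    · exact fun S T hST hT => hT.mono fun n hn t ht => hn t (hST ht)
    · intro S T hS hT
      filter_upwards [hS, hT] with n h1 h2 t ht
      exact ht.elim (h1 t) (h2 t)
    · intro t₀ _
      refine ⟨_, mem_nhdsWithin_of_mem_nhds
        ((continuous_rightTranslate f).continuousAt.eventually (Metric.ball_mem_nhds _ hη)), ?_⟩
      filter_upwards [(h (rightTranslate t₀ f)).eventually (Metric.ball_mem_nhds _ hη)]
        with n hn t ht
      rw [dist_eq_norm] at hn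
      replace ht : ‖rightTranslate t f - rightTranslate t₀ f‖ < δ * M / 3 := by
        simpa [dist_eq_norm] using ht
      have b : ∀ B : StrongDual ℂ C₀(G, ℂ), ‖B‖ ≤ 1 →
          ‖B (rightTranslate t f) - B (rightTranslate t₀ f)‖ ≤ δ * M / 3 := fun B hB => by
        rw [← map_sub]
        exact ((B.le_of_opNorm_le hB _).trans_eq (one_mul _)).trans ht.le
      have h1 := b _ (hA n)
      have h2 := b _ hν
      simp only [convOp_apply]
      have e : (A n) (rightTranslate t f) - ν (rightTranslate t f) =
          ((A n) (rightTranslate t f) - (A n) (rightTranslate t₀ f)) +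
          ((A n) (rightTranslate t₀ f) - ν (rightTranslate t₀ f)) -
          (ν (rightTranslate t f) - ν (rightTranslate t₀ f)) := by ring
      rw [e]
      refine (norm_sub_le _ _).trans ?_
      linarith [norm_add_le ((A n) (rightTranslate t f) - (A n) (rightTranslate t₀ f))
        ((A n) (rightTranslate t₀ f) - ν (rightTranslate t₀ f))]
  filter_upwards [hunif] with n hn
  have hc : ∀ B : StrongDual ℂ C₀(G, ℂ), ‖B‖ ≤ 1 → ‖convOp B f‖ ≤ ‖f‖ := fun B hB =>
    ((convOp B).le_of_opNorm_le ((norm_convOp_le B).trans hB) f).trans_eq (one_mul _)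
  have := hKδ ((M : ℂ)⁻¹ • (convOp (A n) f - convOp ν f)) ?_ ?_
  · rw [map_smul, norm_smul, norm_inv, Complex.norm_real, Real.norm_of_nonneg hMpos.le,
      inv_mul_eq_div, div_le_div_iff_of_pos_right hMpos, map_sub] at this
    rw [dist_eq_norm]
    linarith
  · rw [norm_smul, norm_inv, Complex.norm_real, Real.norm_of_nonneg hMpos.le, inv_mul_eq_div,
      div_le_one hMpos]
    linarith [norm_sub_le (convOp (A n) f) (convOp ν f), hc _ (hA n), hc _ hν]
  · intro s hs
    rw [ZeroAtInftyContinuousMap.smul_apply, norm_smul, norm_inv, Complex.norm_real,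
      Real.norm_of_nonneg hMpos.le, inv_mul_eq_div, div_le_iff₀ hMpos]
    exact hn s hs

/-- A weak* cluster point `ν` of the Cesàro averages of a contraction `ρ` satisfies `ν ⋆ ρ = ν`, so
that all functions `L_ν f` are fixed points of `L_ρ`. If `0` is the only fixed point, then `ν = 0`
for each cluster point `ν`, and by weak* compactness of the unit ball the averages tend to `0`. -/
theorem tendsto_cesaro_zero_of_fixC0 {ρ : StrongDual ℂ C₀(G, ℂ)} (hρ : ‖ρ‖ ≤ 1)
    (hfix : fixC0 ρ = {0}) : Tendsto (cesaro ρ) atTop (𝓝 0) := by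
  rw [tendsto_iff_ultrafilter]
  intro U hU
  obtain ⟨ν, hν1, hν⟩ := (WeakDual.isCompact_closedBall (0 : StrongDual ℂ C₀(G, ℂ)) 1)
    |>.ultrafilter_le_nhds (U.map (cesaro ρ)) (by
      rw [le_principal_iff, Ultrafilter.coe_map, mem_map]
      exact Eventually.of_forall fun n => by simpa using norm_cesaro_le_one hρ n)
  replace hν : Tendsto (cesaro ρ) U (𝓝 ν) := hν
  set ν' : StrongDual ℂ C₀(G, ℂ) := WeakDual.toStrongDual ν with hν'
  replace hν1 : ‖ν'‖ ≤ 1 := by simpa using hν1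
  have hlim : ∀ f, Tendsto (fun n => cesaro ρ n f) U (𝓝 (ν' f)) :=
    tendsto_iff_forall_eval_tendsto_topDualPairing.1 hν
  have hinv : ∀ f, ρ (convOp ν' f) = ν' f := fun f => by
    have h1 := tendsto_apply_convOp (norm_cesaro_le_one hρ) hν1 hlim ρ f
    have h2 : Tendsto (fun n => ρ (convOp (WeakDual.toStrongDual (cesaro ρ n)) f) - cesaro ρ n f)
        U (𝓝 0) := by
      refine Tendsto.mono_left ?_ hU
      have h3 := tendsto_birkhoffAverage_apply_sub_birkhoffAverage ℂ (f := convOp ρ)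
        (g := _root_.id) (x := convOp ρ f) ?_
      · refine ((diracOne.continuous.tendsto 0).comp h3).congr fun n => ?_
        rw [← convOp_apply_one ρ, convOp_cesaro, cesaro_apply_eq_birkhoffAverage]
        exact congrArg (fun g : C₀(G, ℂ) => g 1 - _)
          (apply_birkhoffAverage (convOp ρ : C₀(G, ℂ) →ₗ[ℂ] C₀(G, ℂ)) n (convOp ρ f)).symm
      · refine isBounded_iff_forall_norm_le.2 ⟨‖convOp ρ f‖, ?_⟩
        rintro _ ⟨n, rfl⟩
        simpa [iterate_map_zero] using
          ((lipschitzWith_convOp hρ).iterate n).dist_le_mul (convOp ρ f) 0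
    have := h1.sub h2
    simp only [sub_sub_cancel, sub_zero] at this
    exact tendsto_nhds_unique this (hlim f)
  have h0 : ν = 0 := by
    refine DFunLike.ext _ _ fun f => ?_
    have hmem : convOp ν' f ∈ fixC0 ρ := ZeroAtInftyContinuousMap.ext fun t => by
      rw [convOp_apply, ← convOp_rightTranslate, hinv, convOp_apply]
    rw [hfix, Set.mem_singleton_iff] at hmem
    calc ν f = convOp ν' f 1 := (convOp_apply_one ν' f).symm
      _ = 0 := by rw [hmem]; rfl
  rwa [h0] at hν

end Convolution

/-! ### The character attached to a nonzero fixed point -/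

section Fix

variable {G : Type*} [Group G] [TopologicalSpace G] [IsTopologicalGroup G]
  [LocallyCompactSpace G] [T2Space G] [MeasurableSpace G] [BorelSpace G]

/-- A nonzero fixed point `f` of `L_ω` determines the character. If `|f|` is maximal at `t`, then
equality holds throughout in `|f(t)| = |∫ f(s t) dω(s)| ≤ ∫ |f(s t)| d|ω|(s) ≤ |f(t)|`. So
multiplication by elements of the support of `|ω|` maps the compact set where `|f|` is maximal into
itself, and `f (s t) = F(s) f(t)` on it, with `ω = conj F |ω|`. The set of `s` with these properties
is a compact submonoid, hence a subgroup, on which `F` is multiplicative. -/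
theorem exists_character_of_fixC0 (ω : ComplexMeasure G) (hreg : ω.variation.Regular)
    (hω : ω.variation Set.univ ≤ 1) {f : C₀(G, ℂ)} (hf0 : f ≠ 0) (hf : f ∈ fixC0 (toDual ω)) :
    ω.variation Set.univ = 1 ∧ IsCompact (supportSubgroup ω.variation : Set G) ∧
      ∃ χ : supportSubgroup ω.variation →ₜ* Circle, ω = charMeasure χ ω.variation := by
  obtain ⟨t₀, ht₀, hpos⟩ := exists_norm_eq_norm hf0
  set c := ‖f‖ with hc
  have hfc := map_continuous f
  have hne : ∀ {t}, ‖f t‖ = c → f t ≠ 0 := fun h => norm_pos_iff.1 (h ▸ hpos)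
  have key : ∀ t, ‖f t‖ = c → ω.variation Set.univ = 1 ∧
      (∀ᵐ s ∂ω.variation, ‖f (s * t) / f t‖ = 1) ∧
      ω = ω.variation.withDensityᵥ fun s => star (f (s * t) / f t) := fun t ht => by
    refine eq_withDensityᵥ_of_cintegral_eq_one ω hω (by fun_prop) (fun s => ?_) ?_
    · rw [norm_div, ht]
      exact (div_le_one hpos).2 (norm_apply_le f _)
    · have h1 : cintegral ω (fun s => f (s * t)) = f t := DFunLike.congr_fun hf t
      simp_rw [div_eq_inv_mul, cintegral_const_mul, h1]
      exact inv_mul_cancel₀ (hne ht)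
  set F : G → ℂ := fun s => f (s * t₀) / f t₀ with hF
  have hFc : Continuous F := by fun_prop
  have hfin := isFiniteMeasure_variation ω
  have hsupp : ∀ s ∈ ω.variation.support, ∀ t, ‖f t‖ = c →
      ‖f (s * t)‖ = c ∧ f (s * t) = F s * f t := by
    intro s hs t ht
    obtain ⟨-, h1, h2⟩ := key t ht
    obtain ⟨-, -, h3⟩ := key t₀ ht₀
    have hae : ∀ᵐ s ∂ω.variation, ‖f (s * t)‖ = c ∧ f (s * t) = F s * f t := by
      have hi : ∀ t, ‖f t‖ = c → Integrable (fun s => star (f (s * t) / f t)) ω.variation :=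
        fun t ht => .of_bound (Continuous.aestronglyMeasurable (by fun_prop)) 1
          (.of_forall fun s => by
            rw [norm_star, norm_div, ht]
            exact (div_le_one hpos).2 (norm_apply_le f _))
      filter_upwards [h1, (hi t ht).ae_eq_of_withDensityᵥ_eq (hi t₀ ht₀) (h2.symm.trans h3)]
        with s hs1 hs2
      rw [norm_div, ht, div_eq_one_iff_eq hpos.ne'] at hs1
      exact ⟨hs1, by rw [show F s = f (s * t) / f t from (star_injective hs2).symm,
        div_mul_cancel₀ _ (hne ht)]⟩
    exact Measure.support_subset_of_isClosed (IsClosed.and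
      (isClosed_eq (by fun_prop) continuous_const) (isClosed_eq (by fun_prop) (by fun_prop))) hae hs
  have hmul : ∀ a b, (∀ t, ‖f t‖ = c → ‖f (a * t)‖ = c ∧ f (a * t) = F a * f t) →
      ‖f (b * t₀)‖ = c → F (a * b) = F a * F b := fun a b ha hb => by
    simp only [hF]
    rw [mul_assoc, (ha _ hb).2, mul_div_assoc]
  -- the submonoid of elements acting by `F` on the set where `|f|` is maximal
  let T : Submonoid G :=
    { carrier := {s | ∀ t, ‖f t‖ = c → ‖f (s * t)‖ = c ∧ f (s * t) = F s * f t}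
      one_mem' := fun t ht => by simp [hF, ht, hne ht₀]
      mul_mem' := fun {a b} ha hb t ht => by
        rw [mul_assoc, (ha _ (hb t ht).1).2, (hb t ht).2, hmul a b ha (hb t₀ ht₀).1, mul_assoc]
        refine ⟨?_, rfl⟩
        rw [← (hb t ht).2, ← (ha _ (hb t ht).1).2]
        exact (ha _ (hb t ht).1).1 }
  have hTclosed : IsClosed (T : Set G) := by
    have : (T : Set G) = ⋂ t, ⋂ (_ : ‖f t‖ = c), {s | ‖f (s * t)‖ = c ∧ f (s * t) = F s * f t} := by
      ext s; simp [T]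
    rw [this]
    exact isClosed_iInter fun t => isClosed_iInter fun _ => IsClosed.and
      (isClosed_eq (by fun_prop) continuous_const) (isClosed_eq (by fun_prop) (by fun_prop))
  have hTcompact : IsCompact (T : Set G) :=
    ((Homeomorph.mulRight t₀).isClosedEmbedding.isCompact_preimage
      (isCompact_norm_eq (f := f) hpos)).of_isClosed_subset hTclosed fun s hs => (hs t₀ ht₀).1
  let H : Subgroup G :=
    { T with inv_mem' := fun hs => inv_mem_of_isCompact_submonoid T hTcompact hs }
  set K := supportSubgroup ω.variation
  have hKH : K ≤ H := supportSubgroup_le hTclosed hsupp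
  have hF1 : ∀ s ∈ K, ‖F s‖ = 1 := fun s hs => by
    simp only [hF]
    rw [norm_div, ((hKH hs : s ∈ T) t₀ ht₀).1, ht₀, div_self hpos.ne']
  let χ : K →ₜ* Circle :=
    { toFun := fun s => ⟨star (F s), mem_sphere_zero_iff_norm.2 (by rw [norm_star, hF1 s s.2])⟩
      map_one' := Subtype.ext (by simp [hF, hne ht₀])
      map_mul' := fun a b => Subtype.ext
        ((congrArg star (hmul a b (hKH a.2) ((hKH b.2 : (b : G) ∈ T) t₀ ht₀).1)).trans
          (star_mul' _ _))
      continuous_toFun := by fun_prop }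
  refine ⟨(key t₀ ht₀).1, hTcompact.of_isClosed_subset (isClosed_supportSubgroup _) hKH, χ, ?_⟩
  refine (key t₀ ht₀).2.2.trans (WithDensityᵥEq.congr_ae ?_)
  filter_upwards [Measure.support_mem_ae_of_regular (μ := ω.variation)] with s hs
  rw [charExtend_of_mem χ (support_subset_supportSubgroup _ hs)]
  rfl

end Fix

/-! ### Harmonic functions on compact groups -/

section Compact

variable {Q : Type*} [Group Q] [TopologicalSpace Q] [IsTopologicalGroup Q] [CompactSpace Q]

/-- If a function is bounded by the modulus of its mean `c`, then it equals `c` almost everywhere,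
by strict convexity of the discs of `ℂ`. -/
theorem ae_eq_of_integral_eq {X : Type*} [MeasurableSpace X] (ν : Measure X)
    [IsProbabilityMeasure ν] {w : X → ℂ} {c : ℂ} (hw : ∀ x, ‖w x‖ ≤ ‖c‖) (h : ∫ x, w x ∂ν = c) :
    ∀ᵐ x ∂ν, w x = c := by
  rcases ae_eq_const_or_norm_integral_lt_of_norm_le_const (μ := ν) (.of_forall hw) with h1 | h1
  · rwa [average_eq_integral, h] at h1
  · simp [h] at h1

/-- The maximum principle on a compact group `Q`: if a continuous function is harmonic, in the sense
that its value at `k` is the `ν`-average of its values at `θ(s) k`, and if the values of `θ` on the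
support of `ν` topologically generate `Q`, then it is constant. -/
theorem eq_apply_one_of_harmonic [T2Space Q] {Y : Type*} [TopologicalSpace Y] [MeasurableSpace Y]
    (ν : Measure Y) [IsProbabilityMeasure ν] {θ : Y → Q} (hθ : Continuous θ)
    (hgen : ∀ H : Subgroup Q, IsClosed (H : Set Q) → (∀ s ∈ ν.support, θ s ∈ H) → H = ⊤)
    {v : Q → ℂ} (hv : Continuous v) (h : ∀ k, v k = ∫ s, v (θ s * k) ∂ν) (k : Q) : v k = v 1 := by
  obtain ⟨x₀, -, hx₀⟩ := isCompact_univ.exists_isMaxOn (Set.univ_nonempty (α := Q))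
    hv.norm.continuousOn
  have hmax : ∀ x, ‖v x‖ ≤ ‖v x₀‖ := fun x => hx₀ (Set.mem_univ x)
  let T : Submonoid Q :=
    { carrier := {q | ∀ x, v x = v x₀ → v (q * x) = v x₀}
      one_mem' := fun x hx => by rwa [one_mul]
      mul_mem' := fun ha hb x hx => by
        rw [mul_assoc]
        exact ha _ (hb x hx) }
  have hTclosed : IsClosed (T : Set Q) := by
    have : (T : Set Q) = ⋂ x, ⋂ (_ : v x = v x₀), {q | v (q * x) = v x₀} := by
      ext q; simp [T]
    rw [this]
    exact isClosed_iInter fun x => isClosed_iInter fun _ =>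
      isClosed_eq (by fun_prop) continuous_const
  let H : Subgroup Q :=
    { T with inv_mem' := fun hs => inv_mem_of_isCompact_submonoid T hTclosed.isCompact hs }
  have hH : H = ⊤ := hgen H hTclosed fun s hs x hx => by
    have hae := ae_eq_of_integral_eq ν (w := fun s => v (θ s * x)) (c := v x₀)
      (fun s => hmax _) (by rw [← h x, hx])
    exact Measure.support_subset_of_isClosed
      (isClosed_eq (by fun_prop) continuous_const : IsClosed {s | v (θ s * x) = v x₀}) hae hs
  have hall : ∀ k, v k = v x₀ := fun k => by
    have : k * x₀⁻¹ ∈ H := hH ▸ Subgroup.mem_top _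
    simpa using this x₀ rfl
  rw [hall k, hall 1]

variable [MeasurableSpace Q] [BorelSpace Q]

/-- Haar measure on a compact group is invariant under conjugation, hence right invariant. -/
theorem isMulRightInvariant_of_compactSpace (m : Measure Q) [m.IsHaarMeasure] :
    m.IsMulRightInvariant where
  map_mul_right_eq_self t := by
    have hconj : MeasurePreserving (MulAut.conj t⁻¹).toMonoidHom m m :=
      MonoidHom.measurePreserving (f := (MulAut.conj t⁻¹).toMonoidHom)
        (show Continuous fun s => t⁻¹ * s * t⁻¹⁻¹ by fun_prop) (MulAut.conj t⁻¹).surjective rfl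
    have h := ((measurePreserving_mul_left m t).comp hconj).map_eq
    convert h using 2
    ext s
    simp [mul_assoc]

instance isProbabilityMeasure_haarMeasure_top :
    IsProbabilityMeasure (Measure.haarMeasure (⊤ : TopologicalSpace.PositiveCompacts Q)) :=
  ⟨Measure.haarMeasure_self⟩

end Compact

/-! ### Left translations -/

section LeftTranslate

variable {G : Type*} [Group G] [TopologicalSpace G] [IsTopologicalGroup G]

/-- The left translate `s ↦ f (t * s)` of `f ∈ C₀(G)`. -/
noncomputable def leftTranslate (t : G) (f : C₀(G, ℂ)) : C₀(G, ℂ) :=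
  f.comp (Homeomorph.mulLeft t).toCocompactMap

@[simp] theorem leftTranslate_apply (t s : G) (f : C₀(G, ℂ)) :
    leftTranslate t f s = f (t * s) := rfl

theorem leftTranslate_leftTranslate (s t : G) (f : C₀(G, ℂ)) :
    leftTranslate s (leftTranslate t f) = leftTranslate (t * s) f :=
  ZeroAtInftyContinuousMap.ext fun x => by simp [mul_assoc]

/-- Left translation on `C₀(G)` is norm continuous, as it is conjugate to right translation by the
inversion of `G`. -/
theorem continuous_leftTranslate [LocallyCompactSpace G] (f : C₀(G, ℂ)) :
    Continuous fun t : G => leftTranslate t f := by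
  set f' : C₀(G, ℂ) := f.comp (Homeomorph.inv G).toCocompactMap with hf'
  have hc : Continuous fun t : G => rightTranslate t⁻¹ f' :=
    (continuous_rightTranslate f').comp continuous_inv
  refine continuous_iff_continuousAt.2 fun t₀ => tendsto_iff_norm_sub_tendsto_zero.2 ?_
  refine squeeze_zero (fun _ => norm_nonneg _) (fun t => ?_)
    (tendsto_iff_norm_sub_tendsto_zero.1 (hc.tendsto t₀))
  refine norm_le_of_forall (norm_nonneg _) fun s => ?_
  refine le_of_eq_of_le ?_ (norm_apply_le (rightTranslate t⁻¹ f' - rightTranslate t₀⁻¹ f') s⁻¹)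
  have e : ∀ x, f' x = f x⁻¹ := fun x => rfl
  simp [e]

theorem norm_leftTranslate_le (t : G) (f : C₀(G, ℂ)) : ‖leftTranslate t f‖ ≤ ‖f‖ :=
  norm_le_of_forall (norm_nonneg _) fun s => norm_apply_le f (t * s)

end LeftTranslate

/-! ### Convolution with `χ ν` for a measure `ν` on a compact subgroup -/

theorem isClosed_of_compactSpace_subgroup {G : Type*} [Group G] [TopologicalSpace G]
    [T2Space G] (K : Subgroup G) [CompactSpace K] :
    IsClosed (K : Set G) :=
  (isCompact_iff_compactSpace.2 ‹_›).isClosed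

theorem norm_charExtend_le {G : Type*} [Group G] [TopologicalSpace G] {K : Subgroup G}
    (χ : K →ₜ* Circle) (s : G) : ‖charExtend χ s‖ ≤ 1 := by
  unfold charExtend
  split_ifs
  · exact (Circle.norm_coe _).le
  · simp

theorem measurableEmbedding_val {G : Type*} [Group G] [TopologicalSpace G] [T2Space G]
    [MeasurableSpace G] [BorelSpace G] (K : Subgroup G) [CompactSpace K] :
    MeasurableEmbedding (Subtype.val : K → G) :=
  .subtype_coe (isClosed_of_compactSpace_subgroup K).measurableSet

theorem measurable_charExtend {G : Type*} [Group G] [TopologicalSpace G] [T2Space G]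
    [MeasurableSpace G] [BorelSpace G] {K : Subgroup G} [CompactSpace K] (χ : K →ₜ* Circle) :
    Measurable (charExtend χ) := by
  have hχ : Continuous fun k : K => (χ k : ℂ) :=
    continuous_subtype_val.comp (map_continuous χ)
  have : charExtend χ = Function.extend Subtype.val (fun k : K => (χ k : ℂ)) 0 := by
    ext s
    by_cases hs : s ∈ K
    · rw [charExtend_of_mem χ hs]
      exact (Subtype.val_injective.extend_apply (fun k : K => (χ k : ℂ)) 0 ⟨s, hs⟩).symm
    · rw [Function.extend_apply' _ _ _ (by rintro ⟨a, rfl⟩; exact hs a.2), charExtend, dif_neg hs]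
      rfl
  rw [this]
  exact (measurableEmbedding_val K).measurable_extend hχ.measurable measurable_const

section Character

variable {G : Type*} [Group G] [TopologicalSpace G] [T2Space G] [MeasurableSpace G] [BorelSpace G]
  {K : Subgroup G} [CompactSpace K]

theorem cintegral_charMeasure (χ : K →ₜ* Circle) (ν : Measure K) [IsFiniteMeasure ν] {g : G → ℂ}
    (hg : Integrable g (ν.map Subtype.val)) :
    cintegral (charMeasure χ (ν.map Subtype.val)) g = ∫ k : K, χ k * g k ∂ν := by
  rw [charMeasure, cintegral_withDensityᵥ _ (measurable_charExtend χ) (norm_charExtend_le χ) hg,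
    (measurableEmbedding_val K).integral_map]
  refine integral_congr_ae (.of_forall fun k => ?_)
  simp only [charExtend_of_mem χ k.2]

theorem toDual_charMeasure (χ : K →ₜ* Circle) (ν : Measure K) [IsFiniteMeasure ν] (f : C₀(G, ℂ)) :
    toDual (charMeasure χ (ν.map Subtype.val)) f = ∫ k : K, χ k * f k ∂ν :=
  cintegral_charMeasure χ ν <|
    .of_bound (map_continuous f).measurable.aestronglyMeasurable ‖f‖ (.of_forall (norm_apply_le f))

end Character

/-! ### Twisted-invariant functions -/

section Twisted

variable {G : Type*} [Group G] [TopologicalSpace G]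

/-- The functions `f ∈ C₀(G)` with `f (k t) = conj χ(k) f(t)` for `k` in the subgroup `K`. -/
def twistedInvariant {K : Subgroup G} (χ : K →ₜ* Circle) : Set C₀(G, ℂ) :=
  {f | ∀ (k : K) (t : G), f (k * t) = star (χ k : ℂ) * f t}

theorem character_mul_star {K : Subgroup G} (χ : K →ₜ* Circle) (k : K) :
    (χ k : ℂ) * star (χ k : ℂ) = 1 := by
  rw [RCLike.star_def, Complex.mul_conj, Circle.normSq_coe, Complex.ofReal_one]

theorem character_inv {K : Subgroup G} (χ : K →ₜ* Circle) (k : K) :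
    (χ k⁻¹ : ℂ) = star (χ k : ℂ) := by
  rw [map_inv, Circle.coe_inv_eq_conj]
  rfl

theorem character_mul {K : Subgroup G} (χ : K →ₜ* Circle) (k l : K) :
    (χ (k * l) : ℂ) = χ k * χ l := by
  rw [map_mul, Circle.coe_mul]

theorem coe_inv_character {K : Subgroup G} (χ : K →ₜ* Circle) (k : K) :
    ((χ⁻¹ : K →ₜ* Circle) k : ℂ) = star (χ k : ℂ) :=
  Circle.coe_inv_eq_conj (χ k)

theorem continuous_character {K : Subgroup G} (χ : K →ₜ* Circle) :
    Continuous fun k : K => (χ k : ℂ) :=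
  continuous_subtype_val.comp (map_continuous χ)

variable [IsTopologicalGroup G] [T2Space G] [MeasurableSpace G] [BorelSpace G]
  [LocallyCompactSpace G] {K : Subgroup G} [CompactSpace K]

theorem convOp_charMeasure_of_twistedInvariant (χ : K →ₜ* Circle) (ν : Measure K)
    [IsProbabilityMeasure ν] {f : C₀(G, ℂ)} (hf : f ∈ twistedInvariant χ) :
    convOp (toDual (charMeasure χ (ν.map Subtype.val))) f = f := by
  refine ZeroAtInftyContinuousMap.ext fun t => ?_
  rw [convOp_apply, toDual_charMeasure]
  have : ∀ k : K, (χ k : ℂ) * rightTranslate t f k = f t := fun k => by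
    rw [rightTranslate_apply, hf k t, ← mul_assoc, character_mul_star, one_mul]
  simp_rw [this]
  simp

theorem convOp_haarOn_mem_twistedInvariant (χ : K →ₜ* Circle) (f : C₀(G, ℂ)) :
    convOp (toDual (charMeasure χ (haarOn K))) f ∈ twistedInvariant χ := by
  intro k t
  have := isMulRightInvariant_of_compactSpace
    (Measure.haarMeasure (⊤ : TopologicalSpace.PositiveCompacts K))
  rw [haarOn, convOp_apply, convOp_apply, toDual_charMeasure, toDual_charMeasure,
    ← MeasureTheory.integral_const_mul, ← integral_mul_right_eq_self
      (fun l : K => star (χ k : ℂ) * ((χ l : ℂ) * rightTranslate t f l)) k]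
  refine integral_congr_ae (.of_forall fun l => ?_)
  simp only [rightTranslate_apply, character_mul, Subgroup.coe_mul, mul_assoc]
  linear_combination (-(χ l : ℂ) * f (l * (k * t))) * character_mul_star χ k

/-- `L_{χ ν} f` is the Bochner integral in `C₀(G)` of the left translates of `f` against `χ ν`. -/
theorem apply_convOp_charMeasure (χ : K →ₜ* Circle) (ν : Measure K) [IsFiniteMeasure ν]
    (φ : StrongDual ℂ C₀(G, ℂ)) (f : C₀(G, ℂ)) :
    φ (convOp (toDual (charMeasure χ (ν.map Subtype.val))) f) =
      ∫ k : K, χ k * φ (leftTranslate (k : G) f) ∂ν := by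
  have hc : Continuous fun k : K => (χ k : ℂ) • leftTranslate (k : G) f :=
    (continuous_character χ).smul ((continuous_leftTranslate f).comp continuous_subtype_val)
  have hint : Integrable (fun k : K => (χ k : ℂ) • leftTranslate (k : G) f) ν :=
    .of_bound hc.aestronglyMeasurable_of_compactSpace ‖f‖ (.of_forall fun k => by
      rw [norm_smul, Circle.norm_coe, one_mul]
      exact norm_leftTranslate_le _ f)
  have hconv : convOp (toDual (charMeasure χ (ν.map Subtype.val))) f =
      ∫ k : K, (χ k : ℂ) • leftTranslate (k : G) f ∂ν := by
    refine ZeroAtInftyContinuousMap.ext fun t => ?_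
    let δ : StrongDual ℂ C₀(G, ℂ) := LinearMap.mkContinuous
      { toFun := fun f => f t
        map_add' := fun _ _ => rfl
        map_smul' := fun _ _ => rfl } 1 fun f => by simpa using norm_apply_le f t
    rw [convOp_apply, toDual_charMeasure]
    exact δ.integral_comp_comm hint
  rw [hconv, ← φ.integral_comp_comm hint]
  simp only [map_smul, smul_eq_mul]

/-- A functional `φ` on `C₀(G)` which is invariant under `L_{χ ν}` satisfies
`φ (f (k ·)) = conj χ(k) φ(f)` for `k ∈ K`, by the maximum principle for the function
`k ↦ χ(k) φ (f (k ·))` on `K`. -/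
theorem apply_leftTranslate_of_invariant (χ : K →ₜ* Circle) (ν : Measure K)
    [IsProbabilityMeasure ν]
    (hgen : ∀ H : Subgroup K, IsClosed (H : Set K) → ν.support ⊆ H → H = ⊤)
    {φ : StrongDual ℂ C₀(G, ℂ)}
    (hφ : ∀ f, φ (convOp (toDual (charMeasure χ (ν.map Subtype.val))) f) = φ f)
    (f : C₀(G, ℂ)) (k : K) : (χ k : ℂ) * φ (leftTranslate (k : G) f) = φ f := by
  have h := eq_apply_one_of_harmonic ν (θ := fun s : K => s⁻¹) continuous_inv
    (fun H hH hs => hgen H hH fun s hsν => inv_mem_iff.1 (hs s hsν))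
    (v := fun k : K => (χ k⁻¹ : ℂ) * φ (leftTranslate ((k⁻¹ : K) : G) f))
    (((continuous_character χ).comp continuous_inv).mul
      (φ.continuous.comp ((continuous_leftTranslate f).comp
        (continuous_subtype_val.comp continuous_inv)))) (fun k => ?_) k⁻¹
  · have e : leftTranslate (1 : G) f = f := ZeroAtInftyContinuousMap.ext fun s => by simp
    simpa [e] using h
  · rw [← hφ, apply_convOp_charMeasure, ← MeasureTheory.integral_const_mul]
    refine integral_congr_ae (.of_forall fun s => ?_)
    simp only [leftTranslate_leftTranslate, mul_inv_rev, inv_inv, character_mul, mul_assoc,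
      Subgroup.coe_mul]

theorem apply_convOp_haarOn_of_invariant (χ : K →ₜ* Circle) (ν : Measure K)
    [IsProbabilityMeasure ν]
    (hgen : ∀ H : Subgroup K, IsClosed (H : Set K) → ν.support ⊆ H → H = ⊤)
    {φ : StrongDual ℂ C₀(G, ℂ)}
    (hφ : ∀ f, φ (convOp (toDual (charMeasure χ (ν.map Subtype.val))) f) = φ f)
    (f : C₀(G, ℂ)) : φ (convOp (toDual (charMeasure χ (haarOn K))) f) = φ f := by
  rw [haarOn, apply_convOp_charMeasure]
  simp [apply_leftTranslate_of_invariant χ ν hgen hφ f]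

/-- Fixed points of `L_{χ ν}` are twisted-invariant, by the maximum principle for the functions
`k ↦ χ(k) f (k t)` on `K`. -/
theorem fixC0_charMeasure (χ : K →ₜ* Circle) (ν : Measure K) [IsProbabilityMeasure ν]
    (hgen : ∀ H : Subgroup K, IsClosed (H : Set K) → ν.support ⊆ H → H = ⊤) :
    fixC0 (toDual (charMeasure χ (ν.map Subtype.val))) = twistedInvariant χ := by
  refine Set.Subset.antisymm (fun f hf k t => ?_)
    fun f hf => convOp_charMeasure_of_twistedInvariant χ ν hf
  have h := eq_apply_one_of_harmonic ν (θ := fun s : K => s) continuous_id hgen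
    (v := fun k : K => (χ k : ℂ) * f (k * t)) ((continuous_character χ).mul
      ((map_continuous f).comp (continuous_subtype_val.mul continuous_const))) (fun k => ?_) k
  · simp only [map_one, Circle.coe_one, Subgroup.coe_one, one_mul] at h
    linear_combination (-f (k * t)) * character_mul_star χ k + star (χ k : ℂ) * h
  · have h1 : convOp (toDual (charMeasure χ (ν.map Subtype.val))) f (k * t) = f (k * t) :=
      DFunLike.congr_fun hf _
    rw [convOp_apply, toDual_charMeasure] at h1
    rw [← h1, ← MeasureTheory.integral_const_mul]
    refine integral_congr_ae (.of_forall fun s => ?_)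
    simp only [rightTranslate_apply, character_mul, Subgroup.coe_mul, mul_assoc]
    ring

theorem fixC0_haarOn (χ : K →ₜ* Circle) :
    fixC0 (toDual (charMeasure χ (haarOn K))) = twistedInvariant χ :=
  fixC0_charMeasure χ _ fun H _ hs => by
    rw [Measure.support_eq_univ, Set.univ_subset_iff] at hs
    exact SetLike.coe_injective (by simpa using hs)

theorem range_convOp_haarOn (χ : K →ₜ* Circle) :
    Set.range (convOp (toDual (charMeasure χ (haarOn K)))) = twistedInvariant χ := by
  refine Set.Subset.antisymm ?_ fun f hf =>
    ⟨f, convOp_charMeasure_of_twistedInvariant χ _ hf⟩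
  rintro _ ⟨f, rfl⟩
  exact convOp_haarOn_mem_twistedInvariant χ f

/-- The functional `χ m_K` is nonzero: it is positive on a bump function at `1` supported where
`Re χ > 0`. -/
theorem exists_toDual_haarOn_ne_zero (χ : K →ₜ* Circle) :
    ∃ f, toDual (charMeasure χ (haarOn K)) f ≠ 0 := by
  have hopen : IsOpen {k : K | 0 < (χ k : ℂ).re} :=
    isOpen_lt continuous_const (Complex.continuous_re.comp (continuous_character χ))
  obtain ⟨W, hW, hWK⟩ := isOpen_induced_iff.1 hopen
  have h1W : (1 : G) ∈ W := by
    have : (1 : K) ∈ Subtype.val ⁻¹' W := by rw [hWK]; simp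
    simpa using this
  obtain ⟨b, hb1, hb0, hbc, hb⟩ := exists_continuous_one_zero_of_isCompact
    (isCompact_singleton (x := (1 : G))) hW.isClosed_compl (by simpa using h1W)
  let f : C₀(G, ℂ) :=
    { toFun := fun s => (b s : ℂ)
      continuous_toFun := by fun_prop
      zero_at_infty' := HasCompactSupport.is_zero_at_infty
        (hbc.comp_left (g := ((↑) : ℝ → ℂ)) Complex.ofReal_zero) }
  have hf : ∀ s, f s = b s := fun s => rfl
  refine ⟨f, fun h0 => ?_⟩
  rw [haarOn, toDual_charMeasure] at h0
  have hc : Continuous fun k : K => (χ k : ℂ) * f k :=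
    (continuous_character χ).mul ((map_continuous f).comp continuous_subtype_val)
  have hpos : 0 < ∫ k : K, ((χ k : ℂ) * f k).re
      ∂Measure.haarMeasure (⊤ : TopologicalSpace.PositiveCompacts K) := by
    refine Continuous.integral_pos_of_hasCompactSupport_nonneg_nonzero (x := 1)
      (Complex.continuous_re.comp hc) (HasCompactSupport.of_compactSpace _) (fun k => ?_) ?_
    · simp only [Pi.zero_apply, hf, Complex.re_mul_ofReal]
      by_cases hk : (k : G) ∈ W
      · have : k ∈ {k : K | 0 < (χ k : ℂ).re} := hWK ▸ hk
        exact mul_nonneg (le_of_lt this) (hb k).1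
      · simp [hb0 hk]
    · simp [hf, hb1 rfl]
  refine hpos.ne' ?_
  have hint := hc.integrable_of_hasCompactSupport (HasCompactSupport.of_compactSpace _)
    (μ := Measure.haarMeasure (⊤ : TopologicalSpace.PositiveCompacts K))
  exact (integral_re hint).trans (by rw [h0]; rfl)

end Twisted

/-! ### Mean ergodic convergence -/

/-- By the Hahn–Banach theorem, a vector annihilated by all functionals vanishing on a subspace
lies in its closure. -/
theorem mem_closure_of_forall_dual {E : Type*} [NormedAddCommGroup E] [NormedSpace ℂ E]
    (p : Submodule ℂ E) {x : E}
    (h : ∀ φ : StrongDual ℂ E, (∀ y ∈ p, φ y = 0) → φ x = 0) : x ∈ closure (p : Set E) := by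
  by_contra hx
  obtain ⟨φ, u, h1, h2⟩ := RCLike.geometric_hahn_banach_closed_point (𝕜 := ℂ)
    (p.restrictScalars ℝ).convex.closure isClosed_closure hx
  have h0 : ∀ y ∈ p, φ y = 0 := fun y hy => by
    by_contra hne
    have := h1 (((u : ℂ) / φ y) • y) (subset_closure (p.smul_mem _ hy))
    rw [map_smul, smul_eq_mul, div_mul_cancel₀ _ hne] at this
    simp at this
  have h3 := h1 0 (subset_closure p.zero_mem)
  rw [h φ h0] at h2
  simp only [map_zero] at h2 h3
  linarith

section Ergodic

variable {G : Type*} [Group G] [TopologicalSpace G] [IsTopologicalGroup G] [T2Space G]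
  [MeasurableSpace G] [BorelSpace G] [LocallyCompactSpace G] {K : Subgroup G} [CompactSpace K]

/-- The mean ergodic theorem for `L = L_{χ ν}`, with limit the projection `P = L_{χ m_K}`: invariant
functionals do not distinguish `f` from `P f`, so `f - P f` lies in the closure of the range of
`L - 1`. -/
theorem tendsto_birkhoffAverage_convOp (χ : K →ₜ* Circle) (ν : Measure K)
    [IsProbabilityMeasure ν]
    (hgen : ∀ H : Subgroup K, IsClosed (H : Set K) → ν.support ⊆ H → H = ⊤)
    (hnorm : ‖toDual (charMeasure χ (ν.map Subtype.val))‖ ≤ 1) (f : C₀(G, ℂ)) :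
    Tendsto (birkhoffAverage ℂ (convOp (toDual (charMeasure χ (ν.map Subtype.val)))) _root_.id · f)
      atTop (𝓝 (convOp (toDual (charMeasure χ (haarOn K))) f)) := by
  set L := convOp (toDual (charMeasure χ (ν.map Subtype.val))) with hL
  set P := convOp (toDual (charMeasure χ (haarOn K))) with hP
  have hLP : ∀ f, L (P f) = P f := fun f =>
    convOp_charMeasure_of_twistedInvariant χ ν (convOp_haarOn_mem_twistedInvariant χ f)
  have hPf : ∀ f, L f = f → P f = f := fun f hf =>
    convOp_charMeasure_of_twistedInvariant χ _ (fixC0_charMeasure χ ν hgen ▸ hf)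
  let P' : C₀(G, ℂ) →L[ℂ] LinearMap.eqLocus (L : C₀(G, ℂ) →ₗ[ℂ] C₀(G, ℂ)) 1 :=
    P.codRestrict _ fun f => hLP f
  refine LinearMap.tendsto_birkhoffAverage_of_ker_subset_closure
    (L : C₀(G, ℂ) →ₗ[ℂ] C₀(G, ℂ)) (lipschitzWith_convOp hnorm) P'
    (fun x => Subtype.ext (hPf x x.2)) (fun g hg => ?_) f
  refine mem_closure_of_forall_dual _ fun φ hφ => ?_
  have h1 := apply_convOp_haarOn_of_invariant χ ν hgen (φ := φ) (fun g => sub_eq_zero.1 <| by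
    rw [← map_sub]
    exact hφ _ ⟨g, rfl⟩) g
  have h2 : P g = 0 := congrArg Subtype.val hg
  rw [← h1]
  change φ (P g) = 0
  rw [h2, map_zero]

theorem tendsto_cesaro_charMeasure (χ : K →ₜ* Circle) (ν : Measure K) [IsProbabilityMeasure ν]
    (hgen : ∀ H : Subgroup K, IsClosed (H : Set K) → ν.support ⊆ H → H = ⊤)
    (hnorm : ‖toDual (charMeasure χ (ν.map Subtype.val))‖ ≤ 1) :
    Tendsto (cesaro (toDual (charMeasure χ (ν.map Subtype.val)))) atTop
      (𝓝 (StrongDual.toWeakDual (toDual (charMeasure χ (haarOn K))))) := by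
  refine tendsto_iff_forall_eval_tendsto_topDualPairing.2 fun f => ?_
  set L := convOp (toDual (charMeasure χ (ν.map Subtype.val))) with hL
  have h : Tendsto (fun n => L (birkhoffAverage ℂ L _root_.id n f)) atTop
      (𝓝 (convOp (toDual (charMeasure χ (haarOn K))) f)) := by
    rw [← convOp_charMeasure_of_twistedInvariant χ ν (convOp_haarOn_mem_twistedInvariant χ f)]
    exact (L.continuous.tendsto _).comp (tendsto_birkhoffAverage_convOp χ ν hgen hnorm f)
  have h1 := (diracOne.continuous.tendsto _).comp h
  simp only [diracOne_apply, convOp_apply_one] at h1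
  refine h1.congr fun n => ?_
  refine Eq.trans ?_ (cesaro_apply_eq_birkhoffAverage _ n f).symm
  exact congrArg (fun g : C₀(G, ℂ) => g 1)
    (apply_birkhoffAverage (L : C₀(G, ℂ) →ₗ[ℂ] C₀(G, ℂ)) n f)

end Ergodic

/-! ### Fixed points in `L^∞` of a compact group -/

theorem ae_eq_zero_of_forall_continuous {G : Type*} [TopologicalSpace G] [T2Space G]
    [MeasurableSpace G] [BorelSpace G] [CompactSpace G] (m : Measure G) [m.Regular]
    [IsFiniteMeasure m] {f : G → ℂ} (hf : MemLp f 2 m)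
    (h : ∀ g : C(G, ℂ), ∫ t, g t * f t ∂m = 0) : f =ᵐ[m] 0 := by
  have h0 : hf.toLp f = 0 := by
    refine (ContinuousMap.toLp_denseRange ℂ m ℂ (p := 2)
      ENNReal.ofNat_ne_top).eq_zero_of_inner_right ℂ ?_
    intro g
    rw [L2.inner_def, ← h (star g)]
    refine integral_congr_ae ?_
    filter_upwards [hf.coeFn_toLp, ContinuousMap.coeFn_toLp (𝕜 := ℂ) (p := 2) m g] with t h1 h2
    rw [h1, h2]
    simp [mul_comm]
  exact hf.coeFn_toLp.symm.trans ((Lp.ext_iff.1 h0).trans (Lp.coeFn_zero ℂ 2 m))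

/-- The functional `g ↦ ∫ g f dm` on `C₀(G)` given by an integrable density `f`. -/
noncomputable def densityFunctional {G : Type*} [TopologicalSpace G] [MeasurableSpace G]
    [BorelSpace G] (m : Measure G) {f : G → ℂ} (hf : Integrable f m) : StrongDual ℂ C₀(G, ℂ) :=
  LinearMap.mkContinuous
    { toFun := fun g => ∫ t, g t * f t ∂m
      map_add' := fun g h => by
        simp only [ZeroAtInftyContinuousMap.add_apply, add_mul]
        refine integral_add ?_ ?_ <;>
        exact hf.bdd_mul (map_continuous _).measurable.aestronglyMeasurable
          (.of_forall (norm_apply_le _))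
      map_smul' := fun c g => by
        simp only [ZeroAtInftyContinuousMap.smul_apply, smul_eq_mul, mul_assoc, RingHom.id_apply]
        exact MeasureTheory.integral_const_mul _ _ }
    (∫ t, ‖f t‖ ∂m) fun g => by
      rw [mul_comm, ← MeasureTheory.integral_const_mul]
      refine norm_integral_le_of_norm_le (hf.norm.const_mul _) (.of_forall fun t => ?_)
      rw [norm_mul]
      exact mul_le_mul_of_nonneg_right (norm_apply_le g t) (norm_nonneg _)

theorem densityFunctional_apply {G : Type*} [TopologicalSpace G] [MeasurableSpace G]
    [BorelSpace G] (m : Measure G) {f : G → ℂ} (hf : Integrable f m) (g : C₀(G, ℂ)) :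
    densityFunctional m hf g = ∫ t, g t * f t ∂m := rfl

theorem densityFunctional_leftTranslate {G : Type*} [Group G] [TopologicalSpace G]
    [IsTopologicalGroup G] [MeasurableSpace G] [BorelSpace G] (m : Measure G)
    [m.IsMulLeftInvariant] {f : G → ℂ}
    (hf : Integrable f m) (s : G) (g : C₀(G, ℂ)) :
    densityFunctional m hf (leftTranslate s⁻¹ g) = ∫ t, g t * f (s * t) ∂m := by
  rw [densityFunctional_apply, ← integral_mul_left_eq_self _ s]
  simp

theorem haarOn_eq_haarMeasure_of_eq_top {G : Type*} [Group G] [TopologicalSpace G]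
    [IsTopologicalGroup G] [MeasurableSpace G] [BorelSpace G] [CompactSpace G] {K : Subgroup G}
    [CompactSpace K] (hK : K = ⊤) :
    haarOn K = Measure.haarMeasure (⊤ : TopologicalSpace.PositiveCompacts G) :=
  (MonoidHom.measurePreserving (f := K.subtype)
    (μ := Measure.haarMeasure (⊤ : TopologicalSpace.PositiveCompacts K))
    (ν := Measure.haarMeasure (⊤ : TopologicalSpace.PositiveCompacts G))
    continuous_subtype_val (fun s => ⟨⟨s, hK ▸ Subgroup.mem_top s⟩, rfl⟩) (by simp)).map_eq

theorem continuous_charExtend_of_eq_top {G : Type*} [Group G] [TopologicalSpace G]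
    {K : Subgroup G} (hK : K = ⊤) (χ : K →ₜ* Circle) :
    Continuous (charExtend χ) := by
  have h : ∀ s, s ∈ K := fun s => hK ▸ Subgroup.mem_top s
  have : charExtend χ = fun s => (χ ⟨s, h s⟩ : ℂ) := funext fun s => charExtend_of_mem χ (h s)
  rw [this]
  exact (continuous_character χ).comp (continuous_id.subtype_mk h)

section Linfty

variable {G : Type*} [Group G] [TopologicalSpace G] [IsTopologicalGroup G] [T2Space G]
  [MeasurableSpace G] [BorelSpace G] {K : Subgroup G} [CompactSpace K]

/-- The multiples of `conj χ` are fixed points in `L^∞`. -/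
theorem mem_fixLinfty_of_ae_eq (hK : K = ⊤) (χ : K →ₜ* Circle) (ν : Measure K)
    [IsProbabilityMeasure ν] (m : Measure G) [m.IsMulLeftInvariant] (f : Lp ℂ ∞ m) {c : ℂ}
    (hf : ∀ᵐ t ∂m, f t = c * star (charExtend χ t)) :
    f ∈ fixLinfty m (charMeasure χ (ν.map Subtype.val)) := by
  intro φ
  have hX := (continuous_charExtend_of_eq_top hK χ).star
  have hfin : IsFiniteMeasure (ν.map (Subtype.val : K → G)) := inferInstance
  have h1 : ∀ s, ∫ t, φ t * f (s * t) ∂m =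
      star (charExtend χ s) * ∫ t, φ t * f t ∂m := fun s => by
    rw [← MeasureTheory.integral_const_mul]
    refine integral_congr_ae ?_
    filter_upwards [hf, (measurePreserving_mul_left m s).quasiMeasurePreserving.ae hf] with t h1 h2
    have hs : s ∈ K := hK ▸ Subgroup.mem_top s
    have ht : t ∈ K := hK ▸ Subgroup.mem_top t
    rw [h1, h2, charExtend_of_mem χ (K.mul_mem hs ht), charExtend_of_mem χ hs,
      charExtend_of_mem χ ht, show (⟨s * t, _⟩ : K) = ⟨s, hs⟩ * ⟨t, ht⟩ from rfl, character_mul,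
      star_mul']
    ring
  simp_rw [h1]
  rw [cintegral_charMeasure χ ν]
  · have h2 : ∀ k : K, (χ k : ℂ) * (star (charExtend χ (k : G)) * ∫ t, φ t * f t ∂m) =
        ∫ t, φ t * f t ∂m := fun k => by
      rw [charExtend_of_mem χ k.2, ← mul_assoc, character_mul_star, one_mul]
    simp_rw [h2]
    simp
  · exact (Integrable.of_bound hX.measurable.aestronglyMeasurable 1
      (.of_forall fun s => by rw [norm_star]; exact norm_charExtend_le χ s)).mul_const _

variable [CompactSpace G]

/-- If `f` is a fixed point in `L^∞`, the functional `Φ(g) = ∫ g f dm` satisfies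
`Φ (g (k ·)) = χ(k) Φ(g)`, by the maximum principle for `k ↦ χ(k) Φ (g (k⁻¹ ·))`. -/
theorem densityFunctional_of_mem_fixLinfty (χ : K →ₜ* Circle) (ν : Measure K)
    [IsProbabilityMeasure ν]
    (hgen : ∀ H : Subgroup K, IsClosed (H : Set K) → ν.support ⊆ H → H = ⊤)
    (m : Measure G) [m.IsMulLeftInvariant] [IsFiniteMeasure m] (f : Lp ℂ ∞ m)
    (hint : Integrable f m) (hf : f ∈ fixLinfty m (charMeasure χ (ν.map Subtype.val)))
    (g : C₀(G, ℂ)) (k : K) :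
    densityFunctional m hint (leftTranslate (k : G) g) = χ k * densityFunctional m hint g := by
  set Φ := densityFunctional m hint with hΦ
  have hfix : ∀ g, Φ g = ∫ k : K, χ k * Φ (leftTranslate (k : G)⁻¹ g) ∂ν := fun g => by
    have hg : MemLp g 1 m := memLp_one_iff_integrable.2 (Integrable.of_bound
      (map_continuous g).measurable.aestronglyMeasurable ‖g‖ (.of_forall (norm_apply_le g)))
    have h1 := hf (hg.toLp g)
    have h2 : ∀ s, ∫ t, hg.toLp g t * f (s * t) ∂m = Φ (leftTranslate s⁻¹ g) := fun s => by
      rw [hΦ, densityFunctional_leftTranslate]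
      refine integral_congr_ae ?_
      filter_upwards [hg.coeFn_toLp] with t ht
      rw [ht]
    have h3 : ∫ t, hg.toLp g t * f t ∂m = Φ g := by
      refine integral_congr_ae ?_
      filter_upwards [hg.coeFn_toLp] with t ht
      rw [ht]
    simp_rw [h2] at h1
    rw [h3, cintegral_charMeasure χ ν] at h1
    · exact h1
    · have hc : Continuous fun s : G => Φ (leftTranslate s⁻¹ g) :=
        Φ.continuous.comp ((continuous_leftTranslate g).comp continuous_inv)
      exact hc.integrable_of_hasCompactSupport (HasCompactSupport.of_compactSpace _)
  have h := eq_apply_one_of_harmonic ν (θ := fun s : K => s) continuous_id hgen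
    (v := fun k : K => (χ k : ℂ) * Φ (leftTranslate (k : G)⁻¹ g)) ((continuous_character χ).mul
      (Φ.continuous.comp ((continuous_leftTranslate g).comp
        (continuous_inv.comp continuous_subtype_val)))) (fun k => ?_) k⁻¹
  · have e : leftTranslate (1 : G) g = g := ZeroAtInftyContinuousMap.ext fun s => by simp
    simp only [Subgroup.coe_inv, inv_inv, map_one, Circle.coe_one, Subgroup.coe_one, inv_one, e,
      one_mul, character_inv] at h
    linear_combination (-Φ (leftTranslate (k : G) g)) * character_mul_star χ k + (χ k : ℂ) * h
  · rw [hfix, ← MeasureTheory.integral_const_mul]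
    refine integral_congr_ae (.of_forall fun s => ?_)
    simp only [leftTranslate_leftTranslate, mul_inv_rev, character_mul, Subgroup.coe_mul]
    ring

/-- Fixed points in `L^∞` are multiples of `conj χ`. Averaging the relation
`χ(k)⁻¹ Φ (g (k ·)) = Φ(g)` over `k` replaces `g` by a multiple of `χ`. -/
theorem ae_eq_of_mem_fixLinfty (hK : K = ⊤) (χ : K →ₜ* Circle) (ν : Measure K)
    [IsProbabilityMeasure ν]
    (hgen : ∀ H : Subgroup K, IsClosed (H : Set K) → ν.support ⊆ H → H = ⊤)
    (m : Measure G) [m.IsMulLeftInvariant] [IsFiniteMeasure m] [m.Regular] (hm : m = haarOn K)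
    (f : Lp ℂ ∞ m) (hf : f ∈ fixLinfty m (charMeasure χ (ν.map Subtype.val))) :
    ∃ c : ℂ, ∀ᵐ t ∂m, f t = c * star (charExtend χ t) := by
  have hint : Integrable f m := (Lp.memLp f).integrable le_top
  have hX := continuous_charExtend_of_eq_top hK χ
  set c := ∫ t, charExtend χ t * f t ∂m with hc
  have key : ∀ g : C₀(G, ℂ), ∫ t, g t * f t ∂m = (∫ t, star (charExtend χ t) * g t ∂m) * c := by
    intro g
    have h1 : densityFunctional m hint (convOp (toDual (charMeasure χ⁻¹ (haarOn K))) g) =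
        densityFunctional m hint g := by
      have h : ∀ k : K, ((χ⁻¹ : K →ₜ* Circle) k : ℂ) *
          densityFunctional m hint (leftTranslate (k : G) g) = densityFunctional m hint g :=
        fun k => by
          rw [densityFunctional_of_mem_fixLinfty χ ν hgen m f hint hf, coe_inv_character]
          linear_combination densityFunctional m hint g * character_mul_star χ k
      rw [haarOn, apply_convOp_charMeasure]
      simp_rw [h]
      simp
    have h2 : ∀ t, convOp (toDual (charMeasure χ⁻¹ (haarOn K))) g t =
        charExtend χ t * ∫ t, star (charExtend χ t) * g t ∂m := fun t => by
      have ht : t ∈ K := hK ▸ Subgroup.mem_top t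
      have h := convOp_haarOn_mem_twistedInvariant χ⁻¹ g ⟨t, ht⟩ 1
      rw [mul_one, coe_inv_character, star_star, convOp_apply_one] at h
      rw [h, charExtend_of_mem χ ht, hm, haarOn, toDual_charMeasure,
        (measurableEmbedding_val K).integral_map]
      congr 1
      refine integral_congr_ae (.of_forall fun k => ?_)
      simp only [coe_inv_character, charExtend_of_mem χ k.2]
    rw [← densityFunctional_apply m hint g, ← h1, densityFunctional_apply]
    simp_rw [h2]
    rw [hc, ← MeasureTheory.integral_const_mul]
    refine integral_congr_ae (.of_forall fun t => ?_)
    ring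
  refine ⟨c, ?_⟩
  have hmem : MemLp (fun t => f t - c * star (charExtend χ t)) 2 m := by
    refine MemLp.sub ((Lp.memLp f).mono_exponent le_top) (MemLp.const_mul ?_ c)
    exact .of_bound hX.star.measurable.aestronglyMeasurable 1
      (.of_forall fun s => by rw [norm_star]; exact norm_charExtend_le χ s)
  have hzero : ∀ g : C(G, ℂ), ∫ t, g t * (f t - c * star (charExtend χ t)) ∂m = 0 := fun g => by
    have h1 : ∫ t, g t * f t ∂m = (∫ t, star (charExtend χ t) * g t ∂m) * c :=
      key (ZeroAtInftyContinuousMap.ContinuousMap.liftZeroAtInfty g)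
    have hg : Integrable (fun t => g t * f t) m :=
      hint.bdd_mul (map_continuous g).measurable.aestronglyMeasurable
        (.of_forall fun t => g.norm_coe_le_norm t)
    have hgX : Integrable (fun t => star (charExtend χ t) * g t) m :=
      (hX.star.mul (map_continuous g)).integrable_of_hasCompactSupport
        (HasCompactSupport.of_compactSpace _)
    have e : ∀ t, g t * (f t - c * star (charExtend χ t)) =
        g t * f t - (star (charExtend χ t) * g t) * c := fun t => by ring
    simp_rw [e]
    rw [integral_sub hg (hgX.mul_const c), h1, MeasureTheory.integral_mul_const, sub_self]
  filter_upwards [ae_eq_zero_of_forall_continuous m hmem hzero] with t ht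
  exact sub_eq_zero.1 ht

end Linfty

/-! ### Equivalence and limits -/

section Final

variable {G : Type*} [Group G] [TopologicalSpace G] [IsTopologicalGroup G] [T2Space G]
  [MeasurableSpace G] [BorelSpace G]

/-- A regular probability measure `μ` with `G_μ` compact comes from a probability measure on the
group `G_μ`, whose support topologically generates `G_μ`. -/
theorem exists_measure_on_supportSubgroup (μ : Measure G) [μ.Regular] (hμ : μ Set.univ = 1)
    [CompactSpace (supportSubgroup μ)] :
    ∃ ν : Measure (supportSubgroup μ), IsProbabilityMeasure ν ∧ ν.map Subtype.val = μ ∧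
      ∀ H : Subgroup (supportSubgroup μ), IsClosed (H : Set (supportSubgroup μ)) →
        ν.support ⊆ H → H = ⊤ := by
  have hemb := measurableEmbedding_val (supportSubgroup μ)
  have hmap : (μ.comap (Subtype.val : supportSubgroup μ → G)).map Subtype.val = μ := by
    rw [hemb.map_comap, Subtype.range_coe]
    refine Measure.restrict_eq_self_of_ae_mem ?_
    filter_upwards [Measure.support_mem_ae_of_regular (μ := μ)] with s hs
    exact support_subset_supportSubgroup μ hs
  refine ⟨μ.comap Subtype.val, ⟨?_⟩, hmap, fun H hH hs => ?_⟩
  · rw [← hμ, ← hmap, Measure.map_apply hemb.measurable .univ, Set.preimage_univ, hmap]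
  · have hle : supportSubgroup μ ≤ H.map (supportSubgroup μ).subtype := by
      refine supportSubgroup_le ?_ fun s hsμ => ?_
      · rw [Subgroup.coe_map]
        exact (hH.isCompact.image continuous_subtype_val).isClosed
      · refine ⟨⟨s, support_subset_supportSubgroup μ hsμ⟩, hs ?_, rfl⟩
        rw [Measure.mem_support_iff_forall] at hsμ ⊢
        intro U hU
        obtain ⟨V, hV, hVU⟩ := mem_nhds_subtype _ _ _ |>.1 hU
        obtain ⟨V', hV'V, hV'o, hsV'⟩ := mem_nhds_iff.1 hV
        have h1 := hsμ V' (hV'o.mem_nhds hsV')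
        rw [← hmap, Measure.map_apply hemb.measurable hV'o.measurableSet] at h1
        exact h1.trans_le (measure_mono fun x hx => hVU (hV'V hx))
    refine (Subgroup.eq_top_iff' _).2 fun k => ?_
    obtain ⟨l, hl, hlk⟩ := hle k.2
    rwa [← Subtype.ext hlk]

end Final

end CesaroFix

theorem mainTheorem8 {G : Type*} [Group G] [TopologicalSpace G] [IsTopologicalGroup G]
    [LocallyCompactSpace G] [T2Space G] [MeasurableSpace G] [BorelSpace G]
    (ω : ComplexMeasure G) (hreg : ω.variation.Regular) (hω : ω.variation Set.univ ≤ 1) :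
    List.TFAE
      [fixC0 (toDual ω) ≠ {0},
        ω.variation Set.univ = 1 ∧ IsCompact (supportSubgroup ω.variation : Set G) ∧
          ∃ χ : supportSubgroup ω.variation →ₜ* Circle, ω = charMeasure χ ω.variation,
        ¬ Tendsto (cesaro (toDual ω)) atTop (𝓝 0)] ∧
    (ω.variation Set.univ = 1 → ∀ [CompactSpace (supportSubgroup ω.variation)]
      (χ : supportSubgroup ω.variation →ₜ* Circle), ω = charMeasure χ ω.variation →
        Tendsto (cesaro (toDual ω)) atTop
          (𝓝 (StrongDual.toWeakDual
            (toDual (charMeasure χ (haarOn (supportSubgroup ω.variation)))))) ∧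
        fixC0 (toDual ω) =
          fixC0 (toDual (charMeasure χ (haarOn (supportSubgroup ω.variation)))) ∧
        fixC0 (toDual ω) =
          Set.range (convOp (toDual (charMeasure χ (haarOn (supportSubgroup ω.variation))))) ∧
        (∀ [CompactSpace G], supportSubgroup ω.variation = ⊤ →
          ∀ f : Lp ℂ ∞ (Measure.haarMeasure (⊤ : TopologicalSpace.PositiveCompacts G)),
            f ∈ fixLinfty (Measure.haarMeasure (⊤ : TopologicalSpace.PositiveCompacts G)) ω ↔
              ∃ c : ℂ, ∀ᵐ t ∂(Measure.haarMeasure (⊤ : TopologicalSpace.PositiveCompacts G)),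
                f t = c * star (charExtend χ t))) := by
  have hconv : ω.variation Set.univ = 1 → ∀ [CompactSpace (supportSubgroup ω.variation)]
      (χ : supportSubgroup ω.variation →ₜ* Circle), ω = charMeasure χ ω.variation →
        Tendsto (cesaro (toDual ω)) atTop (𝓝 (StrongDual.toWeakDual
          (toDual (charMeasure χ (haarOn (supportSubgroup ω.variation)))))) := by
    intro h1 _ χ hχ
    obtain ⟨ν, _, hν, hgen⟩ := exists_measure_on_supportSubgroup ω.variation h1
    have hων : charMeasure χ (ν.map Subtype.val) = ω := by rw [hν, ← hχ]
    have h := tendsto_cesaro_charMeasure χ ν hgen (by rw [hων]; exact norm_toDual_le_one hω)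
    rwa [hων] at h
  refine ⟨?_, fun h1 _ χ hχ => ⟨hconv h1 χ hχ, ?_⟩⟩
  · tfae_have 1 → 2 := fun h => by
      obtain ⟨f, hf, hf0⟩ : ∃ f ∈ fixC0 (toDual ω), f ≠ 0 := by
        by_contra! h0
        exact h (Set.Subset.antisymm h0 (Set.singleton_subset_iff.2 (map_zero _)))
      exact exists_character_of_fixC0 ω hreg hω hf0 hf
    tfae_have 2 → 3 := fun ⟨h1, hK, χ, hχ⟩ h0 => by
      have : CompactSpace (supportSubgroup ω.variation) := isCompact_iff_compactSpace.1 hK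
      obtain ⟨f, hf⟩ := exists_toDual_haarOn_ne_zero χ
      exact hf (DFunLike.congr_fun (tendsto_nhds_unique (hconv h1 χ hχ) h0) f)
    tfae_have 3 → 1 := fun h hfix =>
      h (tendsto_cesaro_zero_of_fixC0 (norm_toDual_le_one hω) hfix)
    tfae_finish
  · obtain ⟨ν, _, hν, hgen⟩ := exists_measure_on_supportSubgroup ω.variation h1
    have hων : charMeasure χ (ν.map Subtype.val) = ω := by rw [hν, ← hχ]
    have hfix := fixC0_charMeasure χ ν hgen
    rw [hων] at hfix
    rw [hfix, fixC0_haarOn, range_convOp_haarOn]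
    refine ⟨rfl, rfl, fun hK f => ⟨fun hf => ?_, fun ⟨c, hc⟩ => ?_⟩⟩
    · rw [← hων] at hf
      exact ae_eq_of_mem_fixLinfty hK χ ν hgen _ (haarOn_eq_haarMeasure_of_eq_top hK).symm f hf
    · have h := mem_fixLinfty_of_ae_eq hK χ ν _ f hc
      rwa [hων] at h
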